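/- Consider the inviscid Burgers equation $\partial_t u+\partial_x(u^2/2)=0$ on the $2\pi$-periodic torus with initial data $\bar u_\zeta(x)=-\sin(x-\zeta)$, where $\zeta$ is uniformly distributed on $[0,2\pi]$. An entropy solution with initial data $g$ is a bounded measurable function $u(t,x)$, $t\ge 0$, $2\pi$-periodic in $x$, such that for every $t\ge 0$ and every smooth $\varphi(t,x)$ that is $2\pi$-periodic in $x$, $$\int_{-\pi}^{\pi}u(t,x)\varphi(t,x)\,dx=\int_{-\pi}^{\pi}g(x)\varphi(0,x)\,dx+\int_0^t\!\int_{-\pi}^{\pi}\Bigl(u\,\partial_t\varphi+\tfrac12u^2\,\partial_x\varphi\Bigr)dx\,ds,$$ and such that Oleinik's entropy condition holds: for some constant $K\ge0$, $u(t,x+z)-u(t,x)\le K(1+1/t)z$ for all $t>0$, $z>0$ and almost every $x$. A DeepONet with $n$ trunk- /branch-net output functions is a map $a\mapsto\mathcal N(a)$, $\mathcal N(a)(y)=\sum_{k=1}^n\beta_k(a(x_1),\dots,a(x_m))\,\tau_k(y)$, where $x_1,\dots,x_m$ are finitely many sensor points and $\beta:\mathbb R^m\to\mathbb R^n$ (branch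 net) and $\tau:\mathbb R\to\mathbb R^n$ (trunk net) are feed-forward ReLU neural networks. **Theorem.** Let $T>\pi$. For every $\zeta\in[0,2\pi]$ there is an entropy solution $u_\zeta$ of the Burgers equation with initial data $\bar u_\zeta$. Moreover there are constants $c,C>0$, depending only on $T$, such that for every $\varepsilon>0$ there are an integer $n$ with $$c\,\varepsilon^{-2/3}\le n\le C\max(1,\varepsilon^{-2/3})$$ and two DeepONets $\mathcal T_{\theta_T}$ (coordinate net) and $\tilde{\mathcal G}_{\theta_G}$ (solution net), both with $n$ trunk- /branch-net output functions, such that for every $\zeta\in[0,2\pi]$ the map $\xi\mapsto\mathcal T_{\theta_T}(\bar u_\zeta)(\xi)$ is a bijection of $[-\pi,\pi]$ onto itself, and $$\Bigl(\mathbb E_{\zeta}\bigl\|\,u_\zeta(T,\cdot)-\tilde{\mathcal G}_{\theta_G}(\bar u_\zeta)\circ\bigl(\mathcal T_{\theta_T}(\bar u_\zeta)\bigr)^{-1}\bigr\|_{L^2(-\pi,\pi)}^2\Bigr)^{1/2}\le\varepsilon$$ for every choice of entropy solutions $u_\zeta$ with initial data $\bar u_\zeta$, $\zeta\in[0,2\pi]$.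 -/

import Mathlib

open scoped Real ENNReal ContDiff

/-- A feed-forward ReLU neural network with `m` inputs and `n` outputs, given by its weights and
biases: `output A b` is the affine output layer `x ↦ A x + b`, and `hidden A b N` feeds
`ReLU (A x + b)` into the remaining network `N`. Depth and widths are arbitrary. -/
inductive ReLUNet : ℕ → ℕ → Type
  | output {m n : ℕ} (A : Matrix (Fin n) (Fin m) ℝ) (b : Fin n → ℝ) : ReLUNet m n
  | hidden {m k n : ℕ} (A : Matrix (Fin k) (Fin m) ℝ) (b : Fin k → ℝ) (N : ReLUNet k n) :
      ReLUNet m n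

/-- The function realized by a ReLU network. -/
noncomputable def ReLUNet.eval : {m n : ℕ} → ReLUNet m n → (Fin m → ℝ) → (Fin n → ℝ)
  | _, _, .output A b, x => fun i => A.mulVec x i + b i
  | _, _, .hidden A b N, x => N.eval (fun i => max (A.mulVec x i + b i) 0)

/-- A DeepONet (for input functions and output functions of one real variable) with `n` branch-net
and `n` trunk-net output functions: finitely many sensor points at which the input function is
sampled, a branch net acting on the sampled values, and a trunk net acting on the query point. -/
structure DeepONet (n : ℕ) where
  m : ℕ
  sensor : Fin m → ℝ
  branch : ReLUNet m n
  trunk : ReLUNet 1 n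

/-- `N(a)(y) = ∑ₖ βₖ(a(x₁), …, a(xₘ)) τₖ(y)`. -/
noncomputable def DeepONet.eval {n : ℕ} (N : DeepONet n) (a : ℝ → ℝ) (y : ℝ) : ℝ :=
  ∑ k : Fin n, N.branch.eval (fun j => a (N.sensor j)) k * N.trunk.eval (fun _ => y) k

/-- `u = u(t, x)` is an entropy solution of the inviscid Burgers equation
`∂ₜ u + ∂ₓ (u² / 2) = 0` on the `2π`-periodic torus for `t ≥ 0`, with initial data `g`.
Functions on the torus are `2π`-periodic functions on `ℝ`.
The weak formulation is imposed on every time interval `[0, t]`; this singles out the weakly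
continuous representative in time, so that `u t` is well defined almost everywhere for
every `t`. The entropy condition is Oleinik's one-sided Lipschitz condition. -/
structure IsBurgersEntropySolution (g : ℝ → ℝ) (u : ℝ → ℝ → ℝ) : Prop where
  measurable : Measurable (Function.uncurry u)
  periodic : ∀ t, 0 ≤ t → Function.Periodic (u t) (2 * π)
  bounded : ∃ M : ℝ, ∀ t, 0 ≤ t → ∀ᵐ x : ℝ, |u t x| ≤ M
  weak : ∀ φ : ℝ → ℝ → ℝ, ContDiff ℝ ∞ (Function.uncurry φ) →
    (∀ t, Function.Periodic (φ t) (2 * π)) → ∀ t, 0 ≤ t →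
      ∫ x in (-π)..π, u t x * φ t x =
        (∫ x in (-π)..π, g x * φ 0 x) +
          ∫ s in (0 : ℝ)..t, ∫ x in (-π)..π,
            (u s x * deriv (fun r => φ r x) s + u s x ^ 2 / 2 * deriv (φ s) x)
  oleinik : ∃ C : ℝ, 0 ≤ C ∧ ∀ t, 0 < t → ∀ z, 0 < z →
    ∀ᵐ x : ℝ, u t (x + z) - u t x ≤ C * (1 + 1 / t) * z

/-- The random initial data `x ↦ -sin (x - ζ)`. -/
noncomputable def initialData (ζ : ℝ) (x : ℝ) : ℝ := -Real.sin (x - ζ)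

/-- The uniform probability distribution on `[0, 2π]`. -/
noncomputable def uniformShift : MeasureTheory.Measure ℝ :=
  ProbabilityTheory.cond MeasureTheory.volume (Set.Icc 0 (2 * π))

/-- The root-mean-square error
`(𝔼_ζ ‖G(ζ) - S(a_ζ) ∘ (X(a_ζ))⁻¹‖²_{L²(-π,π)})^{1/2}` of the R-adaptive DeepONet system with
coordinate net `X` and solution net `S`, where `a_ζ` is the initial data, `ζ` is uniform
on `[0, 2π]`, and `G ζ` is the target function. -/
noncomputable def rAdaptiveError {n : ℕ} (G : ℝ → ℝ → ℝ) (X S : DeepONet n) : ℝ≥0∞ :=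
  (∫⁻ ζ, (∫⁻ x in Set.Icc (-π) π,
      ENNReal.ofReal ((G ζ x - S.eval (initialData ζ)
        (Function.invFunOn (X.eval (initialData ζ)) (Set.Icc (-π) π) x)) ^ 2))
    ∂uniformShift) ^ (1 / 2 : ℝ)

/-!
# R-adaptive DeepONet approximation of the Burgers solution operator

**Existence.** For the datum `-sin` the solution is explicit. On one period `(0, 2π)` every point
`x` is reached at time `t` by exactly one characteristic `y ↦ y - t sin y` issued from `(0, 2π)`
(`charFoot`), and the solution takes there the value `-sin y`. Since `t u = x - y` and the foot `y`
is nondecreasing in `x`, Oleinik's condition holds with constant `1 / t`. In the coordinates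
`(s, y)` the weak formulation is the integral of a divergence over the set of characteristics which
have not been absorbed by the shocks at `0` and `2π`; the boundary terms along the two sides of the
shock cancel because the solution is odd (`integral_deriv_aliveSet`, `sineSol_weak`). General
phases follow by translation.

**Uniqueness.** For two entropy solutions `u`, `v` let `V` be the difference of their potentials, so
that, up to sign, `∂ₓV = u - v` and `∂ₜV = (u² - v²) / 2`. Hence `V` is transported by the velocity
`a = (u + v) / 2`, and `∂ₓa ≤ k(t) = C (1 + 1 / t)` by Oleinik's condition, which gives
`∫ V(t)^p ≤ ∫₀ᵗ k(s) ∫ V(s)^p ds` for every even `p`. As `V = O(t)`, the function `t^p` dominates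
the left-hand side, and for `p` large the inequality improves this bound by a factor `1 / 2` each
time it is applied; thus `V = 0` (`eq_of_weak_of_oleinik`). Spatial primitives are recovered from
the weak formulation by testing with trigonometric functions.

**Approximation.** For `T > π` the solution at time `T` is a translate of a fixed profile with a
single jump per period, and the profile is smooth up to the jump. The coordinate net realizes
`ξ ↦ ξ + s (1 - |ξ| / π)`, a bijection of `[-π, π]` as long as `|s| < π`, which moves `0` to the
shock position `s`. In the coordinate `ξ` the shock therefore sits at `0` for every phase, and one
fixed family of hat functions, with `N + 1` nodes on either side and a layer of arbitrarily small
width `2δ` around `0`, interpolates all solutions with error `O(N⁻²)`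
(`abs_sineSol_sub_reconstruction_le`). The branch nets have to reproduce continuous functions of
the phase; sampling the datum at two points yields `sin ζ` and `cos ζ`, and a ReLU neuron applied to
these is a translate of a bump, so that a discretized convolution is a shallow network
(`exists_reLUNet_approx`). The shock position is discontinuous in the phase where the shock crosses
`±π`, but the phases close to it have small probability. Only the interpolation error depends on
the number of basis functions, and `N⁻² ≤ C ε` already for `N` of order `ε^(-1/2)`.
-/

/-! ### Analysis on one period -/

open MeasureTheory in
theorem intervalIntegrable_bdd_mul {a h : ℝ → ℝ} (ha : Measurable a) {M : ℝ}
    (haM : ∀ x, |a x| ≤ M) (hh : Continuous h) (c d : ℝ) :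
    IntervalIntegrable (fun x => a x * h x) volume c d := by
  rw [intervalIntegrable_iff]
  refine Integrable.bdd_mul (c := M) (intervalIntegrable_iff.1 (hh.intervalIntegrable c d))
    ha.aestronglyMeasurable (ae_of_all _ fun x => by simpa using haM x)

open MeasureTheory in
theorem intervalIntegrable_mul_bdd {a h : ℝ → ℝ} (ha : Measurable a) {M : ℝ}
    (haM : ∀ x, |a x| ≤ M) (hh : Continuous h) (c d : ℝ) :
    IntervalIntegrable (fun x => h x * a x) volume c d := by
  simpa only [mul_comm] using intervalIntegrable_bdd_mul ha haM hh c d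

open MeasureTheory Filter Topology in
/-- Uniqueness of Fourier coefficients, in real form. -/
theorem ae_eq_zero_of_trig_orthogonal {H : ℝ → ℝ} (hH : Measurable H) {M : ℝ}
    (hM : ∀ x, |H x| ≤ M)
    (hcos : ∀ n : ℤ, ∫ x in (-π)..π, H x * Real.cos (n * x) = 0)
    (hsin : ∀ n : ℤ, ∫ x in (-π)..π, H x * Real.sin (n * x) = 0) :
    ∀ᵐ x ∂volume.restrict (Set.Ioc (-π) π), H x = 0 := by
  have hab : -π < π := by linarith [Real.pi_pos]
  have hHc : Measurable fun x => (H x : ℂ) := Complex.measurable_ofReal.comp hH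
  have hL2 : MemLp (fun x => (H x : ℂ)) 2 (volume.restrict (Set.Ioc (-π) π)) :=
    MemLp.of_bound hHc.aestronglyMeasurable M (ae_of_all _ fun x => by simpa using hM x)
  have hint : ∀ h : ℝ → ℝ, Continuous h →
      IntervalIntegrable (fun x => H x * h x) volume (-π) π := by
    intro h hh
    exact intervalIntegrable_bdd_mul hH hM hh _ _
  have hcoef : ∀ n : ℤ, fourierCoeffOn hab (fun x => (H x : ℂ)) n = 0 := by
    intro n
    rw [fourierCoeffOn_eq_integral]
    have : ∀ x : ℝ, fourier (-n) (x : AddCircle (π - -π)) • (H x : ℂ) =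
        ((H x * Real.cos (n * x) : ℝ) : ℂ) - ((H x * Real.sin (n * x) : ℝ) : ℂ) * Complex.I := by
      intro x
      rw [fourier_coe_apply]
      have h1 : 2 * (π : ℂ) * Complex.I * ((-n : ℤ) : ℂ) * (x : ℂ) / ((π - -π : ℝ) : ℂ) =
          ((-(n * x) : ℝ) : ℂ) * Complex.I := by
        have : (π : ℂ) ≠ 0 := by exact_mod_cast Real.pi_ne_zero
        push_cast
        field_simp
        ring
      rw [h1, Complex.exp_mul_I, ← Complex.ofReal_cos, ← Complex.ofReal_sin]
      simp only [Real.cos_neg, Real.sin_neg, smul_eq_mul]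
      push_cast
      ring
    simp_rw [this]
    rw [intervalIntegral.integral_sub, intervalIntegral.integral_mul_const,
      intervalIntegral.integral_ofReal, intervalIntegral.integral_ofReal, hcos, hsin]
    · simp
    · have h := hint (fun x => Real.cos (n * x)) (by fun_prop)
      exact ⟨h.1.ofReal, h.2.ofReal⟩
    · have h := hint (fun x => Real.sin (n * x)) (by fun_prop)
      exact IntervalIntegrable.mul_const ⟨h.1.ofReal, h.2.ofReal⟩ _
  have hP := hasSum_sq_fourierCoeffOn hab hL2
  simp only [hcoef, norm_zero, ne_eq, OfNat.ofNat_ne_zero, not_false_eq_true, zero_pow] at hP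
  have h0 : (π - -π)⁻¹ • ∫ x in (-π)..π, ‖(H x : ℂ)‖ ^ 2 = 0 := hP.unique hasSum_zero
  have h1 : ∫ x in (-π)..π, ‖(H x : ℂ)‖ ^ 2 = 0 := by
    rcases smul_eq_zero.1 h0 with h | h
    · exact absurd h (inv_ne_zero (by linarith [Real.pi_pos]))
    · exact h
  rw [intervalIntegral.integral_of_le hab.le, integral_eq_zero_iff_of_nonneg_ae
    (ae_of_all _ fun x => by positivity)] at h1
  · filter_upwards [h1] with x hx
    simpa using hx
  · exact hL2.integrable_norm_pow (by norm_num)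

theorem integral_cos_int_mul_period {n : ℤ} (hn : n ≠ 0) :
    ∫ x in (-π)..π, Real.cos (n * x) = 0 := by
  have hn' : (n : ℝ) ≠ 0 := by exact_mod_cast hn
  rw [intervalIntegral.integral_comp_mul_left (fun x => Real.cos x) hn', integral_cos]
  have : (n : ℝ) * -π = -(n * π) := by ring
  rw [this, Real.sin_neg, Real.sin_int_mul_pi]
  simp

theorem integral_sin_int_mul_period (n : ℤ) :
    ∫ x in (-π)..π, Real.sin (n * x) = 0 := by
  rcases eq_or_ne n 0 with rfl | hn
  · simp
  have hn' : (n : ℝ) ≠ 0 := by exact_mod_cast hn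
  rw [intervalIntegral.integral_comp_mul_left (fun x => Real.sin x) hn', integral_sin]
  have : (n : ℝ) * -π = -(n * π) := by ring
  rw [this, Real.cos_neg]
  simp

open MeasureTheory in
/-- A bounded function whose distributional derivative on the torus vanishes is constant. -/
theorem ae_eq_const_of_integral_mul_deriv_eq_zero {H : ℝ → ℝ} (hH : Measurable H) {M : ℝ}
    (hM : ∀ x, |H x| ≤ M)
    (h : ∀ ψ : ℝ → ℝ, ContDiff ℝ ∞ ψ → Function.Periodic ψ (2 * π) →
      ∫ x in (-π)..π, H x * deriv ψ x = 0) :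
    ∃ c : ℝ, ∀ᵐ x ∂volume.restrict (Set.Ioc (-π) π), H x = c := by
  have hint : ∀ h : ℝ → ℝ, Continuous h →
      IntervalIntegrable (fun x => H x * h x) volume (-π) π := by
    intro h hh
    exact intervalIntegrable_bdd_mul hH hM hh _ _
  have hc : ∀ n : ℤ, n ≠ 0 → ∫ x in (-π)..π, H x * Real.cos (n * x) = 0 := by
    intro n hn
    have hn' : (n : ℝ) ≠ 0 := by exact_mod_cast hn
    have h1 := h (fun x => Real.sin (n * x)) (by fun_prop) (by
      intro x
      have : (n : ℝ) * (x + 2 * π) = n * x + n * (2 * π) := by ring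
      simp only [this, Real.sin_add_int_mul_two_pi])
    have h2 : ∀ x : ℝ, H x * deriv (fun x => Real.sin (n * x)) x =
        n * (H x * Real.cos (n * x)) := by
      intro x
      have : HasDerivAt (fun x : ℝ => Real.sin (n * x)) (Real.cos (n * x) * (n * 1)) x :=
        ((hasDerivAt_id x).const_mul (n : ℝ)).sin
      rw [this.deriv]; ring
    simp_rw [h2] at h1
    rw [intervalIntegral.integral_const_mul] at h1
    exact (mul_eq_zero.1 h1).resolve_left hn'
  have hs : ∀ n : ℤ, ∫ x in (-π)..π, H x * Real.sin (n * x) = 0 := by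
    intro n
    rcases eq_or_ne n 0 with rfl | hn
    · simp
    have hn' : (n : ℝ) ≠ 0 := by exact_mod_cast hn
    have h1 := h (fun x => Real.cos (n * x)) (by fun_prop) (by
      intro x
      have : (n : ℝ) * (x + 2 * π) = n * x + n * (2 * π) := by ring
      simp only [this, Real.cos_add_int_mul_two_pi])
    have h2 : ∀ x : ℝ, H x * deriv (fun x => Real.cos (n * x)) x =
        (-n) * (H x * Real.sin (n * x)) := by
      intro x
      have : HasDerivAt (fun x : ℝ => Real.cos (n * x)) (-Real.sin (n * x) * (n * 1)) x :=
        ((hasDerivAt_id x).const_mul (n : ℝ)).cos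
      rw [this.deriv]; ring
    simp_rw [h2] at h1
    rw [intervalIntegral.integral_const_mul] at h1
    exact (mul_eq_zero.1 h1).resolve_left (neg_ne_zero.2 hn')
  set c : ℝ := (2 * π)⁻¹ * ∫ x in (-π)..π, H x with hcdef
  refine ⟨c, ?_⟩
  have hIH : IntervalIntegrable H volume (-π) π := by
    simpa using hint (fun _ => 1) continuous_const
  have key := ae_eq_zero_of_trig_orthogonal (H := fun x => H x - c) (hH.sub_const c)
    (M := M + |c|) (fun x => (abs_sub _ _).trans (by linarith [hM x])) ?_ ?_
  · filter_upwards [key] with x hx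
    linarith
  · intro n
    simp_rw [sub_mul]
    rw [intervalIntegral.integral_sub (hint _ (by fun_prop))
      ((by fun_prop : Continuous fun x : ℝ => c * Real.cos (n * x)).intervalIntegrable _ _),
      intervalIntegral.integral_const_mul]
    rcases eq_or_ne n 0 with rfl | hn
    · simp only [Int.cast_zero, zero_mul, Real.cos_zero, mul_one, intervalIntegral.integral_const,
        smul_eq_mul, hcdef]
      have := Real.pi_ne_zero
      field_simp
      ring
    · rw [hc n hn, integral_cos_int_mul_period hn]; simp
  · intro n
    simp_rw [sub_mul]
    rw [intervalIntegral.integral_sub (hint _ (by fun_prop))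
      ((by fun_prop : Continuous fun x : ℝ => c * Real.sin (n * x)).intervalIntegrable _ _),
      intervalIntegral.integral_const_mul, hs n, integral_sin_int_mul_period]
    simp

open MeasureTheory in
theorem intervalIntegrable_of_measurable_of_bound {f : ℝ → ℝ} (hf : Measurable f) {M : ℝ}
    (hM : ∀ x, |f x| ≤ M) (a b : ℝ) : IntervalIntegrable f volume a b := by
  simpa using intervalIntegrable_bdd_mul hf hM (continuous_const (y := (1 : ℝ))) a b

open MeasureTheory in
theorem locallyIntegrable_of_measurable_of_bound {f : ℝ → ℝ} (hf : Measurable f) {M : ℝ}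
    (hM : ∀ x, |f x| ≤ M) : LocallyIntegrable f volume := by
  refine (locallyIntegrable_const M).mono hf.aestronglyMeasurable (ae_of_all _ fun x => ?_)
  have := hM x
  rw [Real.norm_eq_abs, Real.norm_eq_abs]
  exact this.trans (le_abs_self M)

open MeasureTheory in
theorem lipschitzWith_integral_of_bound {f : ℝ → ℝ} (hf : Measurable f) {M : ℝ}
    (hM : ∀ x, |f x| ≤ M) (a : ℝ) :
    LipschitzWith M.toNNReal fun x => ∫ y in a..x, f y := by
  have h0 : 0 ≤ M := (abs_nonneg _).trans (hM 0)
  refine LipschitzWith.of_dist_le_mul fun x y => ?_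
  have hi := intervalIntegrable_of_measurable_of_bound hf hM
  rw [Real.dist_eq, Real.dist_eq, intervalIntegral.integral_interval_sub_left (hi _ _) (hi _ _),
    Real.coe_toNNReal _ h0]
  exact intervalIntegral.norm_integral_le_of_norm_le_const (f := f) fun x _ => hM x

open MeasureTheory in
/-- Chain rule for powers of an indefinite integral. -/
theorem integral_pow_indefinite {f : ℝ → ℝ} (hf : Measurable f) {M : ℝ}
    (hM : ∀ x, |f x| ≤ M) (p : ℕ) (a t : ℝ) :
    ∫ s in a..t, ((p + 1 : ℕ) : ℝ) * (∫ r in a..s, f r) ^ p * f s =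
      (∫ r in a..t, f r) ^ (p + 1) := by
  set V : ℝ → ℝ := fun s => ∫ r in a..s, f r with hV
  have hVac : AbsolutelyContinuousOnInterval V a t :=
    (intervalIntegrable_of_measurable_of_bound hf hM a t)
      |>.absolutelyContinuousOnInterval_intervalIntegral (by simp)
  have hpow : ∀ q : ℕ, AbsolutelyContinuousOnInterval (fun s => V s ^ (q + 1)) a t := by
    intro q
    induction q with
    | zero => simpa using hVac
    | succ q ih => simpa [pow_succ] using ih.fun_mul hVac
  have h1 := (hpow p).integral_deriv_eq_sub
  have h2 : V a = 0 := by simp [hV]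
  simp only [h2, ne_eq, Nat.add_eq_zero_iff, one_ne_zero, and_false, not_false_eq_true, zero_pow,
    sub_zero] at h1
  rw [← h1]
  refine intervalIntegral.integral_congr_ae ?_
  filter_upwards [LocallyIntegrable.ae_hasDerivAt_integral (locallyIntegrable_of_measurable_of_bound hf hM)]
    with s hs _
  have := (hs a).pow (p + 1)
  simp only [Nat.add_sub_cancel] at this
  exact this.deriv.symm

open MeasureTheory in
/-- Integration by parts of an indefinite integral against a periodic test function, when the
integrand has mean zero over a period. -/
theorem integral_indefinite_mul_deriv {w : ℝ → ℝ} (hw : Measurable w) {M : ℝ}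
    (hM : ∀ x, |w x| ≤ M) (h0 : ∫ x in (-π)..π, w x = 0) {ψ : ℝ → ℝ} (hψ : ContDiff ℝ ∞ ψ) :
    ∫ x in (-π)..π, (∫ y in (-π)..x, w y) * deriv ψ x = - ∫ x in (-π)..π, w x * ψ x := by
  have hG : AbsolutelyContinuousOnInterval (fun x => ∫ y in (-π)..x, w y) (-π) π :=
    (intervalIntegrable_of_measurable_of_bound hw hM (-π) π)
      |>.absolutelyContinuousOnInterval_intervalIntegral (by simp)
  have hψ' : AbsolutelyContinuousOnInterval ψ (-π) π :=
    (hψ.of_le (by norm_num)).contDiffOn.absolutelyContinuousOnInterval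
  rw [hG.integral_mul_deriv_eq_deriv_mul hψ', h0]
  simp only [zero_mul, intervalIntegral.integral_same, sub_self, zero_sub, neg_inj]
  refine intervalIntegral.integral_congr_ae ?_
  filter_upwards [LocallyIntegrable.ae_hasDerivAt_integral (locallyIntegrable_of_measurable_of_bound hw hM)]
    with s hs _
  rw [(hs (-π)).deriv]

open MeasureTheory Filter Topology in
/-- If a bounded periodic coefficient `a` satisfies a one-sided Lipschitz bound with constant `k`,
then `a' ≤ k` in the sense of distributions, tested against a nonnegative Lipschitz function. -/
theorem neg_integral_deriv_mul_le {g g' a : ℝ → ℝ} {K : NNReal} {M k : ℝ}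
    (hgL : LipschitzWith K g) (hgp : Function.Periodic g (2 * π)) (hg0 : ∀ x, 0 ≤ g x)
    (hg' : ∀ᵐ x, HasDerivAt g (g' x) x)
    (ha : Measurable a) (haM : ∀ x, |a x| ≤ M) (hap : Function.Periodic a (2 * π))
    (hak : ∀ z, 0 < z → ∀ᵐ x, a (x + z) - a x ≤ k * z) :
    - ∫ x in (-π)..π, g' x * a x ≤ k * ∫ x in (-π)..π, g x := by
  have hM0 : 0 ≤ M := (abs_nonneg _).trans (haM 0)
  have hgc : Continuous g := hgL.continuous
  have hia : ∀ h : ℝ → ℝ, Continuous h → ∀ c d, IntervalIntegrable (fun x => h x * a x)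
      volume c d := by
    intro h hh c d
    exact intervalIntegrable_mul_bdd ha haM hh c d
  have step : ∀ z : ℝ, 0 < z →
      - ∫ x in (-π)..π, (z⁻¹ * (g x - g (x - z))) * a x ≤ k * ∫ x in (-π)..π, g x := by
    intro z hz
    have e1 : ∫ x in (-π)..π, g (x - z) * a x = ∫ x in (-π)..π, g x * a (x + z) := by
      have hper : Function.Periodic (fun x => g x * a (x + z)) (2 * π) := by
        intro x
        have : x + 2 * π + z = (x + z) + 2 * π := by ring
        simp only [this, hap (x + z), hgp x]
      have h1 := intervalIntegral.integral_comp_sub_right (a := -π) (b := π)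
        (fun x => g x * a (x + z)) z
      simp only [sub_add_cancel] at h1
      rw [h1]
      have h2 := hper.intervalIntegral_add_eq (-π - z) (-π)
      rw [show -π - z + 2 * π = π - z by ring, show -π + 2 * π = π by ring] at h2
      exact h2
    have e2 : ∫ x in (-π)..π, (z⁻¹ * (g x - g (x - z))) * a x =
        z⁻¹ * ∫ x in (-π)..π, -(g x * (a (x + z) - a x)) := by
      simp_rw [mul_assoc, sub_mul]
      rw [intervalIntegral.integral_const_mul, intervalIntegral.integral_sub (hia _ hgc _ _)
        (hia (fun x => g (x - z)) (by fun_prop) _ _), e1]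
      simp_rw [mul_sub]
      rw [intervalIntegral.integral_neg, intervalIntegral.integral_sub]
      · ring
      · exact intervalIntegrable_mul_bdd (M := M) (ha.comp (measurable_add_const z))
          (fun x => haM (x + z)) hgc _ _
      · exact hia _ hgc _ _
    rw [e2, intervalIntegral.integral_neg, mul_neg, neg_neg, ← intervalIntegral.integral_const_mul,
      ← intervalIntegral.integral_const_mul]
    refine intervalIntegral.integral_mono_ae (by linarith [Real.pi_pos]) ?_ ?_ ?_
    · refine IntervalIntegrable.const_mul ?_ _
      simp_rw [mul_sub]
      refine IntervalIntegrable.sub ?_ (hia _ hgc _ _)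
      exact intervalIntegrable_mul_bdd (M := M) (ha.comp (measurable_add_const z))
          (fun x => haM (x + z)) hgc _ _
    · exact (hgc.intervalIntegrable _ _).const_mul _
    · filter_upwards [hak z hz] with x hx
      have : z⁻¹ * (g x * (a (x + z) - a x)) ≤ z⁻¹ * (g x * (k * z)) := by
        have := hg0 x
        gcongr
      refine this.trans (le_of_eq ?_)
      field_simp
  have lim : Tendsto (fun n : ℕ => - ∫ x in (-π)..π,
      ((((1 : ℝ) / (n + 1)))⁻¹ * (g x - g (x - 1 / ((n : ℝ) + 1)))) * a x) atTop
      (𝓝 (- ∫ x in (-π)..π, g' x * a x)) := by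
    refine Tendsto.neg ?_
    refine intervalIntegral.tendsto_integral_filter_of_dominated_convergence
      (fun _ => K * M) ?_ ?_ intervalIntegrable_const ?_
    · refine Eventually.of_forall fun n => ?_
      refine Measurable.aestronglyMeasurable ?_
      have : Measurable g := hgc.measurable
      fun_prop
    · refine Eventually.of_forall fun n => ae_of_all _ fun x _ => ?_
      rw [norm_mul]
      refine mul_le_mul ?_ (by simpa using haM x) (norm_nonneg _) K.2
      have h1 : (0 : ℝ) < 1 / ((n : ℝ) + 1) := by positivity
      have h2 := hgL.dist_le_mul x (x - 1 / ((n : ℝ) + 1))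
      rw [Real.dist_eq, Real.dist_eq, sub_sub_cancel, abs_of_pos h1] at h2
      rw [norm_mul, Real.norm_eq_abs, Real.norm_eq_abs, abs_of_pos (inv_pos.2 h1),
        inv_mul_le_iff₀ h1]
      linarith
    · filter_upwards [hg'] with x hx _
      refine Tendsto.mul_const _ ?_
      have h1 : Tendsto (fun n : ℕ => -((1 : ℝ) / (n + 1))) atTop (𝓝[≠] 0) := by
        refine tendsto_nhdsWithin_iff.2 ⟨?_, Eventually.of_forall fun n => ?_⟩
        · simpa using (tendsto_one_div_add_atTop_nhds_zero_nat (𝕜 := ℝ)).neg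
        · have : (0 : ℝ) < 1 / ((n : ℝ) + 1) := by positivity
          simp only [Set.mem_compl_iff, Set.mem_singleton_iff, neg_eq_zero]
          exact this.ne'
      refine ((hasDerivAt_iff_tendsto_slope_zero.1 hx).comp h1).congr fun n => ?_
      simp only [Function.comp, smul_eq_mul, inv_neg]
      rw [← sub_eq_add_neg]
      ring
  exact le_of_tendsto lim (Eventually.of_forall fun n => step _ (by positivity))

/-! ### Uniqueness of entropy solutions -/

open MeasureTheory in
theorem integrable_prod_of_bound {F : ℝ → ℝ → ℝ} (hF : Measurable (Function.uncurry F)) {K : ℝ}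
    {a b c d : ℝ} (hK : ∀ s ∈ Set.uIoc a b, ∀ x ∈ Set.uIoc c d, |F s x| ≤ K) :
    IntegrableOn (Function.uncurry F) (Set.uIoc a b ×ˢ Set.uIoc c d) := by
  refine Measure.integrableOn_of_bounded (M := K) ?_ hF.aestronglyMeasurable ?_
  · rw [Measure.volume_eq_prod, Measure.prod_prod]
    exact ENNReal.mul_ne_top (by simp [Set.uIoc]) (by simp [Set.uIoc])
  · refine (ae_restrict_iff' (measurableSet_uIoc.prod measurableSet_uIoc)).2 (ae_of_all _ ?_)
    rintro ⟨s, x⟩ ⟨hs, hx⟩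
    exact hK s hs x hx

open MeasureTheory in
theorem measurable_indefinite_integral {b : ℝ → ℝ → ℝ} (hb : Measurable (Function.uncurry b))
    {B : ℝ} (hB : ∀ t x, |b t x| ≤ B) :
    Measurable (Function.uncurry fun t x => ∫ s in (0 : ℝ)..t, b s x) := by
  refine measurable_uncurry_of_continuous_of_measurable (fun x => ?_) (fun t => ?_)
  · exact (lipschitzWith_integral_of_bound (f := fun s => b s x)
      (hb.comp measurable_prodMk_right) (fun s => hB s x) 0).continuous
  · have h : ∀ μ : Measure ℝ, SFinite μ → Measurable fun x => ∫ s, b s x ∂μ := by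
      intro μ _
      exact (StronglyMeasurable.integral_prod_left (f := b) hb.stronglyMeasurable).measurable
    simp only [intervalIntegral]
    exact (h _ inferInstance).sub (h _ inferInstance)

theorem abs_indefinite_integral_le {f : ℝ → ℝ} {B : ℝ} (hB : ∀ x, |f x| ≤ B) {t : ℝ}
    (ht : 0 ≤ t) : |∫ s in (0 : ℝ)..t, f s| ≤ B * t := by
  have := intervalIntegral.norm_integral_le_of_norm_le_const (a := 0) (b := t) (f := f) (C := B)
    fun x _ => hB x
  simpa [abs_of_nonneg ht] using this

open MeasureTheory in
/-- At each time, the time integral of the flux difference `b` is, up to an additive constant,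
minus a spatial primitive of the difference `w` of the two solutions. -/
theorem indefinite_flux_eq_const_sub {b w : ℝ → ℝ → ℝ} (hb : Measurable (Function.uncurry b))
    (hw : Measurable (Function.uncurry w)) {B : ℝ} (hB : ∀ t x, |b t x| ≤ B)
    (hwB : ∀ t x, |w t x| ≤ B)
    (hweak : ∀ ψ : ℝ → ℝ, ContDiff ℝ ∞ ψ → Function.Periodic ψ (2 * π) → ∀ t, 0 ≤ t →
      ∫ x in (-π)..π, w t x * ψ x = ∫ s in (0 : ℝ)..t, ∫ x in (-π)..π, b s x * deriv ψ x)
    {t : ℝ} (ht : 0 ≤ t) :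
    ∃ c, ∀ᵐ x ∂volume.restrict (Set.Ioc (-π) π),
      ∫ s in (0 : ℝ)..t, b s x = c - ∫ y in (-π)..x, w t y := by
  have hwt : Measurable (w t) := hw.comp measurable_prodMk_left
  have hw0 : ∫ x in (-π)..π, w t x = 0 := by
    simpa using hweak (fun _ => 1) contDiff_const (fun _ => rfl) t ht
  have hVm := (measurable_indefinite_integral hb hB).comp (measurable_prodMk_left (x := t))
  have hGL := lipschitzWith_integral_of_bound hwt (hwB t) (-π)
  have hB0 : 0 ≤ B := (abs_nonneg _).trans (hB 0 0)
  -- outside the period the primitive is cut off, to keep the function bounded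
  set G : ℝ → ℝ := fun x => ∫ y in (-π)..x, w t y with hG
  have hGb : ∀ x ∈ Set.Ioc (-π) π, |G x| ≤ B * (2 * π) := by
    intro x hx
    have := intervalIntegral.norm_integral_le_of_norm_le_const (a := -π) (b := x) (f := w t) (C := B)
      fun x _ => hwB t x
    rw [abs_of_nonneg (by linarith [hx.1])] at this
    exact this.trans (mul_le_mul_of_nonneg_left (by linarith [hx.2]) hB0)
  set H : ℝ → ℝ := fun x => (∫ s in (0 : ℝ)..t, b s x) + (Set.Ioc (-π) π).indicator G x with hH
  have hHm : Measurable H := hVm.add (hGL.continuous.measurable.indicator measurableSet_Ioc)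
  have hle : -π ≤ π := by linarith [Real.pi_pos]
  have hHb : ∀ x, |H x| ≤ B * t + B * (2 * π) := by
    intro x
    refine (abs_add_le _ _).trans (add_le_add (abs_indefinite_integral_le (fun s => hB s x) ht) ?_)
    by_cases hx : x ∈ Set.Ioc (-π) π
    · rw [Set.indicator_of_mem hx]; exact hGb x hx
    · rw [Set.indicator_of_notMem hx, abs_zero]
      have := Real.pi_pos
      positivity
  obtain ⟨c, hc⟩ := ae_eq_const_of_integral_mul_deriv_eq_zero hHm hHb (by
    intro ψ hψ hψp
    have hψ' : Continuous (deriv ψ) := hψ.continuous_deriv (by norm_num)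
    obtain ⟨K, hK⟩ := (isCompact_Icc (a := -π) (b := π)).exists_bound_of_continuousOn
      hψ'.continuousOn
    have e1 : ∫ x in (-π)..π, H x * deriv ψ x =
        ∫ x in (-π)..π, (∫ s in (0 : ℝ)..t, b s x * deriv ψ x) + G x * deriv ψ x := by
      rw [intervalIntegral.integral_of_le hle, intervalIntegral.integral_of_le hle]
      refine setIntegral_congr_fun measurableSet_Ioc fun x hx => ?_
      simp only [hH, Set.indicator_of_mem hx, intervalIntegral.integral_mul_const, add_mul]
    have hprod : IntegrableOn (Function.uncurry fun s x => b s x * deriv ψ x)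
        (Set.uIoc 0 t ×ˢ Set.uIoc (-π) π) := by
      refine integrable_prod_of_bound (K := B * K) ?_ ?_
      · exact hb.mul (hψ'.measurable.comp measurable_snd)
      · intro s _ x hx
        rw [Set.uIoc_of_le hle] at hx
        rw [abs_mul]
        exact mul_le_mul (hB s x) (hK x ⟨hx.1.le, hx.2⟩) (abs_nonneg _) hB0
    rw [e1, intervalIntegral.integral_add, ← intervalIntegral_intervalIntegral_swap hprod,
      ← hweak ψ hψ hψp t ht, integral_indefinite_mul_deriv hwt (hwB t) hw0 hψ, add_neg_cancel]
    · simp_rw [intervalIntegral.integral_mul_const]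
      exact intervalIntegrable_bdd_mul hVm
        (fun x => abs_indefinite_integral_le (fun s => hB s x) ht) hψ' _ _
    · exact (hGL.continuous.mul hψ').intervalIntegrable _ _)
  refine ⟨c, ?_⟩
  filter_upwards [hc, ae_restrict_mem measurableSet_Ioc] with x hx hx'
  simp only [hH, Set.indicator_of_mem hx', hG] at hx
  linarith

open MeasureTheory in
/-- Two bounded weak solutions whose mean satisfies Oleinik's condition coincide. The proof
propagates even moments of the difference `V` of the potentials: a high moment vanishes to high
order at `t = 0`, which beats the singular factor `1 / t` in Oleinik's condition. -/
theorem eq_of_weak_of_oleinik {u v : ℝ → ℝ → ℝ} (hu : Measurable (Function.uncurry u))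
    (hv : Measurable (Function.uncurry v)) {M C : ℝ} (huM : ∀ t x, |u t x| ≤ M)
    (hvM : ∀ t x, |v t x| ≤ M) (hC : 0 ≤ C)
    (hup : ∀ t, 0 ≤ t → Function.Periodic (u t) (2 * π))
    (hvp : ∀ t, 0 ≤ t → Function.Periodic (v t) (2 * π))
    (hweak : ∀ ψ : ℝ → ℝ, ContDiff ℝ ∞ ψ → Function.Periodic ψ (2 * π) → ∀ t, 0 ≤ t →
      ∫ x in (-π)..π, (u t x - v t x) * ψ x =
        ∫ s in (0 : ℝ)..t, ∫ x in (-π)..π, ((u s x ^ 2 - v s x ^ 2) / 2) * deriv ψ x)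
    (hole : ∀ t, 0 < t → ∀ z, 0 < z → ∀ᵐ x : ℝ,
      (u t (x + z) + v t (x + z)) / 2 - (u t x + v t x) / 2 ≤ C * (1 + 1 / t) * z)
    {T : ℝ} (hT : 0 ≤ T) :
    ∀ᵐ x ∂volume.restrict (Set.Ioc (-π) π), u T x = v T x := by
  have hle : -π ≤ π := by linarith [Real.pi_pos]
  have hM0 : 0 ≤ M := (abs_nonneg _).trans (huM 0 0)
  set B : ℝ := 2 * M + M ^ 2 with hBdef
  have hB0 : 0 ≤ B := by positivity
  set w : ℝ → ℝ → ℝ := fun t x => u t x - v t x with hwdef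
  set b : ℝ → ℝ → ℝ := fun t x => (u t x ^ 2 - v t x ^ 2) / 2 with hbdef
  set a : ℝ → ℝ → ℝ := fun t x => (u t x + v t x) / 2 with hadef
  have hwm : Measurable (Function.uncurry w) := hu.sub hv
  have hbm : Measurable (Function.uncurry b) := ((hu.pow_const 2).sub (hv.pow_const 2)).div_const 2
  have ham : Measurable (Function.uncurry a) := (hu.add hv).div_const 2
  have hwB : ∀ t x, |w t x| ≤ B := by
    intro t x
    have h1 := abs_le.1 (huM t x)
    have h2 := abs_le.1 (hvM t x)
    refine abs_le.2 ⟨?_, ?_⟩ <;> simp only [hwdef] <;> nlinarith [sq_nonneg M]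
  have hbB : ∀ t x, |b t x| ≤ B := by
    intro t x
    have h1 := sq_le_sq.2 ((huM t x).trans (le_abs_self M))
    have h2 := sq_le_sq.2 ((hvM t x).trans (le_abs_self M))
    refine abs_le.2 ⟨?_, ?_⟩ <;> simp only [hbdef] <;>
      nlinarith [sq_nonneg M, sq_nonneg (u t x), sq_nonneg (v t x)]
  have haM : ∀ t x, |a t x| ≤ M := by
    intro t x
    have h1 := abs_le.1 (huM t x)
    have h2 := abs_le.1 (hvM t x)
    refine abs_le.2 ⟨?_, ?_⟩ <;> simp only [hadef] <;> linarith
  set V : ℝ → ℝ → ℝ := fun t x => ∫ s in (0 : ℝ)..t, b s x with hVdef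
  have hVm : Measurable (Function.uncurry V) := measurable_indefinite_integral hbm hbB
  have hVB : ∀ t, 0 ≤ t → ∀ x, |V t x| ≤ B * t := fun t ht x =>
    abs_indefinite_integral_le (fun s => hbB s x) ht
  have hVc : ∀ t, 0 ≤ t → ∃ c, ∀ᵐ x ∂volume.restrict (Set.Ioc (-π) π),
      V t x = c - ∫ y in (-π)..x, w t y := fun t ht =>
    indefinite_flux_eq_const_sub hbm hwm hbB hwB hweak ht
  have hw0 : ∀ t, 0 ≤ t → ∫ x in (-π)..π, w t x = 0 := by
    intro t ht
    simpa using hweak (fun _ => 1) contDiff_const (fun _ => rfl) t ht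
  obtain ⟨m, hm⟩ := exists_nat_gt (C * (1 + T))
  -- the exponent is even and exceeds twice the Gronwall constant
  set q : ℕ := 2 * m + 1 with hq
  have hqe : Even (q + 1) := ⟨m + 1, by omega⟩
  set E : ℝ → ℝ := fun t => ∫ x in (-π)..π, V t x ^ (q + 1) with hE
  set I : ℝ → ℝ := fun s => ∫ x in (-π)..π, ((q + 1 : ℕ) : ℝ) * V s x ^ q * b s x with hI
  have hInt : ∀ t, 0 ≤ t →
      IntegrableOn (Function.uncurry fun s x => ((q + 1 : ℕ) : ℝ) * V s x ^ q * b s x)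
        (Set.uIoc 0 t ×ˢ Set.uIoc (-π) π) := by
    intro t ht
    refine integrable_prod_of_bound (K := ((q + 1 : ℕ) : ℝ) * (B * t) ^ q * B) ?_ ?_
    · exact ((hVm.pow_const q).const_mul _).mul hbm
    · intro s hs x _
      rw [Set.uIoc_of_le ht] at hs
      rw [abs_mul, abs_mul, abs_pow, Nat.abs_cast]
      have h1 : |V s x| ≤ B * t :=
        (hVB s hs.1.le x).trans (mul_le_mul_of_nonneg_left hs.2 hB0)
      have h2 := hbB s x
      gcongr
  have hEI : ∀ t, 0 ≤ t → E t = ∫ s in (0 : ℝ)..t, I s := by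
    intro t ht
    rw [hI, intervalIntegral_intervalIntegral_swap (hInt t ht)]
    refine intervalIntegral.integral_congr fun x _ => ?_
    exact (integral_pow_indefinite (f := fun s => b s x) (hbm.comp measurable_prodMk_right)
      (fun s => hbB s x) q 0 t).symm
  have hII : ∀ t, 0 ≤ t → IntervalIntegrable I volume 0 t := by
    intro t ht
    have h := hInt t ht
    rw [IntegrableOn, Measure.volume_eq_prod, ← Measure.prod_restrict] at h
    have h2 := h.integral_prod_left
    rw [intervalIntegrable_iff]
    refine h2.congr (ae_of_all _ fun s => ?_)
    simp only [hI, intervalIntegral.integral_of_le hle, Set.uIoc_of_le hle, Function.uncurry]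
  have hIE : ∀ s, 0 < s → I s ≤ C * (1 + 1 / s) * E s := by
    intro s hs
    obtain ⟨c, hc⟩ := hVc s hs.le
    have hws : Measurable (w s) := hwm.comp measurable_prodMk_left
    set W : ℝ → ℝ := fun x => c - ∫ y in (-π)..x, w s y with hW
    have hWper : Function.Periodic W (2 * π) := by
      intro x
      have hi := intervalIntegrable_of_measurable_of_bound hws (hwB s)
      have hp : Function.Periodic (w s) (2 * π) := fun x => by
        simp only [hwdef, hup s hs.le x, hvp s hs.le x]
      have h1 := hp.intervalIntegral_add_eq x (-π)
      rw [show -π + 2 * π = π by ring, hw0 s hs.le] at h1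
      simp only [hW]
      rw [← intervalIntegral.integral_add_adjacent_intervals (hi (-π) x) (hi x (x + 2 * π)), h1,
        add_zero]
    have hWL : LipschitzWith B.toNNReal W := by
      have := lipschitzWith_integral_of_bound hws (hwB s) (-π)
      refine LipschitzWith.of_dist_le_mul fun x y => ?_
      have h := this.dist_le_mul x y
      simp only [hW, dist_sub_left]
      exact h
    have hWc : Continuous W := hWL.continuous
    have hWb : ∃ K : ℝ, 0 ≤ K ∧ ∀ x, |W x| ≤ K := by
      obtain ⟨K, hK⟩ := (hWper.isBounded_of_continuous (by have := Real.pi_pos; positivity)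
        hWc).exists_norm_le
      exact ⟨K, (abs_nonneg _).trans (hK (W 0) ⟨0, rfl⟩), fun x => hK (W x) ⟨x, rfl⟩⟩
    obtain ⟨K, hK0, hK⟩ := hWb
    have hgL : ∃ L : NNReal, LipschitzWith L fun x => W x ^ (q + 1) := by
      refine ⟨(((q + 1 : ℕ) : ℝ) * K ^ q).toNNReal * B.toNNReal, ?_⟩
      have hpow : LipschitzOnWith (((q + 1 : ℕ) : ℝ) * K ^ q).toNNReal
          (fun y : ℝ => y ^ (q + 1)) (Set.Icc (-K) K) := by
        refine (convex_Icc _ _).lipschitzOnWith_of_nnnorm_hasDerivWithin_le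
          (f' := fun y => ((q + 1 : ℕ) : ℝ) * y ^ q) (fun y _ => ?_) (fun y hy => ?_)
        · simpa using (hasDerivAt_pow (q + 1) y).hasDerivWithinAt
        · rw [← NNReal.coe_le_coe, coe_nnnorm, Real.coe_toNNReal _ (by positivity), norm_mul,
            norm_pow, Real.norm_natCast]
          have : ‖y‖ ≤ K := abs_le.2 hy
          gcongr
      have := hpow.comp (hWL.lipschitzOnWith (s := Set.univ)) (fun x _ => abs_le.1 (hK x))
      exact lipschitzOnWith_univ.1 this
    obtain ⟨L, hgL⟩ := hgL
    have key := neg_integral_deriv_mul_le (g := fun x => W x ^ (q + 1))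
      (g' := fun x => ((q + 1 : ℕ) : ℝ) * W x ^ q * (- w s x)) (a := a s) (M := M)
      (k := C * (1 + 1 / s)) hgL (fun x => by simp only [hWper x]) (fun x => hqe.pow_nonneg _) ?_
      (ham.comp measurable_prodMk_left) (haM s) (fun x => by
        simp only [hadef, hup s hs.le x, hvp s hs.le x]) (hole s hs)
    · have e1 : I s = - ∫ x in (-π)..π, (((q + 1 : ℕ) : ℝ) * W x ^ q * (- w s x)) * a s x := by
        rw [← intervalIntegral.integral_neg]
        simp only [hI, intervalIntegral.integral_of_le hle]
        refine integral_congr_ae ?_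
        filter_upwards [hc] with x hx
        rw [hx]
        simp only [hbdef, hwdef, hadef]
        ring
      have e2 : E s = ∫ x in (-π)..π, W x ^ (q + 1) := by
        simp only [hE, intervalIntegral.integral_of_le hle]
        refine integral_congr_ae ?_
        filter_upwards [hc] with x hx
        rw [hx]
      rw [e1, e2]
      exact key
    · filter_upwards [LocallyIntegrable.ae_hasDerivAt_integral
        (locallyIntegrable_of_measurable_of_bound hws (hwB s))] with x hx
      have h := ((hx (-π)).const_sub c).pow (q + 1)
      simp only [Nat.add_sub_cancel] at h
      exact h
  have hdecay : ∀ j : ℕ, ∀ t, 0 ≤ t → t ≤ T →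
      E t ≤ (2 * π * B ^ (q + 1)) * (1 / 2) ^ j * t ^ (q + 1) := by
    intro j
    induction j with
    | zero =>
      intro t ht _
      have h1 := intervalIntegral.norm_integral_le_of_norm_le_const (a := -π) (b := π)
        (f := fun x => V t x ^ (q + 1)) (C := (B * t) ^ (q + 1)) fun x _ => by
          rw [norm_pow]
          exact pow_le_pow_left₀ (norm_nonneg _) (hVB t ht x) _
      have h2 : |π - -π| = 2 * π := by
        rw [abs_of_nonneg (by linarith)]; ring
      rw [h2] at h1
      refine (le_abs_self _).trans (h1.trans (le_of_eq ?_))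
      rw [mul_pow, pow_zero]; ring
    | succ j ih =>
      intro t ht htT
      set L : ℝ := (2 * π * B ^ (q + 1)) * (1 / 2) ^ j with hL
      have hL0 : 0 ≤ L := by have := Real.pi_pos; positivity
      have h1 : ∫ s in (0 : ℝ)..t, I s ≤ ∫ s in (0 : ℝ)..t, (C * (1 + T) * L) * s ^ q := by
        refine intervalIntegral.integral_mono_on_of_le_Ioo ht (hII t ht)
          ((by fun_prop : Continuous fun s : ℝ => (C * (1 + T) * L) * s ^ q).intervalIntegrable _ _)
          fun s hs => ?_
        have hsT : s ≤ T := hs.2.le.trans htT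
        have hE0 : E s ≤ L * s ^ (q + 1) := ih s hs.1.le hsT
        have hs0 : 0 < s := hs.1
        calc I s ≤ C * (1 + 1 / s) * E s := hIE s hs0
          _ ≤ C * (1 + 1 / s) * (L * s ^ (q + 1)) := by gcongr
          _ = C * (1 + s) * L * s ^ q := by field_simp; ring
          _ ≤ C * (1 + T) * L * s ^ q := by gcongr
      rw [hEI t ht]
      refine h1.trans ?_
      rw [intervalIntegral.integral_const_mul, integral_pow]
      have h2 : C * (1 + T) ≤ ((q : ℝ) + 1) / 2 := by
        rw [hq]; push_cast; linarith
      have h3 : (0 : ℝ) < (q : ℝ) + 1 := by positivity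
      calc C * (1 + T) * L * ((t ^ (q + 1) - 0 ^ (q + 1)) / ((q : ℝ) + 1))
          ≤ ((q : ℝ) + 1) / 2 * L * ((t ^ (q + 1) - 0 ^ (q + 1)) / ((q : ℝ) + 1)) := by
            have : 0 ≤ (t ^ (q + 1) - 0 ^ (q + 1)) / ((q : ℝ) + 1) := by
              rw [zero_pow (by omega), sub_zero]; positivity
            gcongr
        _ = (2 * π * B ^ (q + 1)) * (1 / 2) ^ (j + 1) * t ^ (q + 1) := by
            rw [zero_pow (by omega), sub_zero, hL, pow_succ (1 / 2 : ℝ) j]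
            field_simp
  have hET : E T = 0 := by
    refine le_antisymm ?_ ?_
    · have h1 : Filter.Tendsto (fun j : ℕ =>
          (2 * π * B ^ (q + 1)) * (1 / 2 : ℝ) ^ j * T ^ (q + 1)) Filter.atTop (nhds 0) := by
        have := ((tendsto_pow_atTop_nhds_zero_of_lt_one (r := (1 / 2 : ℝ)) (by norm_num)
          (by norm_num)).const_mul (2 * π * B ^ (q + 1))).mul_const (T ^ (q + 1))
        simpa using this
      exact ge_of_tendsto h1 (Filter.Eventually.of_forall fun j => hdecay j T hT le_rfl)
    · exact intervalIntegral.integral_nonneg hle fun x _ => hqe.pow_nonneg _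
  have hV0 : ∀ᵐ x ∂volume.restrict (Set.Ioc (-π) π), V T x = 0 := by
    simp only [hE, intervalIntegral.integral_of_le hle] at hET
    have hVTm : Measurable (V T) := hVm.comp measurable_prodMk_left
    rw [integral_eq_zero_iff_of_nonneg_ae (ae_of_all _ fun x => hqe.pow_nonneg _)] at hET
    · filter_upwards [hET] with x hx
      simpa using hx
    · have := intervalIntegrable_of_measurable_of_bound (hVTm.pow_const (q + 1))
        (M := (B * T) ^ (q + 1)) (fun x => by
          rw [abs_pow]; exact pow_le_pow_left₀ (abs_nonneg _) (hVB T hT x) _) (-π) π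
      exact this.1
  -- the primitive of `w T` is constant on the period, hence `w T` vanishes almost everywhere
  obtain ⟨c, hc⟩ := hVc T hT
  have hwT : Measurable (w T) := hwm.comp measurable_prodMk_left
  have hWcont : Continuous fun x => ∫ y in (-π)..x, w T y :=
    (lipschitzWith_integral_of_bound hwT (hwB T) (-π)).continuous
  have hWeq : Set.EqOn (fun x => ∫ y in (-π)..x, w T y) (fun _ => c) (Set.Ioo (-π) π) := by
    refine Measure.eqOn_open_of_ae_eq (μ := volume) ?_ isOpen_Ioo hWcont.continuousOn
      continuousOn_const
    refine ae_restrict_of_ae_restrict_of_subset Set.Ioo_subset_Ioc_self ?_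
    filter_upwards [hV0, hc] with x h1 h2
    linarith
  rw [← restrict_Ioo_eq_restrict_Ioc]
  filter_upwards [ae_restrict_mem measurableSet_Ioo, ae_restrict_of_ae
    (LocallyIntegrable.ae_hasDerivAt_integral
      (locallyIntegrable_of_measurable_of_bound hwT (hwB T)))] with x hx hx'
  have h1 := hx' (-π)
  have h2 : HasDerivAt (fun x => ∫ y in (-π)..x, w T y) 0 x :=
    (hasDerivAt_const x c).congr_of_eventuallyEq
      (hWeq.eventuallyEq_of_mem (Ioo_mem_nhds hx.1 hx.2))
  have := h1.unique h2
  simp only [hwdef] at this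
  linarith

open MeasureTheory in
/-- A bounded representative of an entropy solution: truncation changes the solution only on a null
set at every time. The weak formulation is kept for test functions of `x` alone. -/
theorem IsBurgersEntropySolution.exists_bounded {g : ℝ → ℝ} {u : ℝ → ℝ → ℝ}
    (hu : IsBurgersEntropySolution g u) :
    ∃ u' : ℝ → ℝ → ℝ, ∃ M C : ℝ, 0 ≤ C ∧ Measurable (Function.uncurry u') ∧
      (∀ t x, |u' t x| ≤ M) ∧ (∀ t, 0 ≤ t → Function.Periodic (u' t) (2 * π)) ∧
      (∀ t, 0 ≤ t → ∀ᵐ x, u' t x = u t x) ∧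
      (∀ ψ : ℝ → ℝ, ContDiff ℝ ∞ ψ → Function.Periodic ψ (2 * π) → ∀ t, 0 ≤ t →
        ∫ x in (-π)..π, u' t x * ψ x = (∫ x in (-π)..π, g x * ψ x) +
          ∫ s in (0 : ℝ)..t, ∫ x in (-π)..π, u' s x ^ 2 / 2 * deriv ψ x) ∧
      (∀ t, 0 < t → ∀ z, 0 < z → ∀ᵐ x : ℝ, u' t (x + z) - u' t x ≤ C * (1 + 1 / t) * z) := by
  obtain ⟨M, hM⟩ := hu.bounded
  obtain ⟨C, hC0, hC⟩ := hu.oleinik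
  have hM0 : 0 ≤ M := by
    obtain ⟨x, hx⟩ := (hM 0 le_rfl).exists
    exact (abs_nonneg _).trans hx
  set u' : ℝ → ℝ → ℝ := fun t x => max (-M) (min M (u t x)) with hu'
  have hae : ∀ t, 0 ≤ t → ∀ᵐ x, u' t x = u t x := by
    intro t ht
    filter_upwards [hM t ht] with x hx
    have := abs_le.1 hx
    simp only [hu', min_eq_right this.2, max_eq_right this.1]
  refine ⟨u', M, C, hC0, ?_, ?_, ?_, hae, ?_, ?_⟩
  · exact measurable_const.max (measurable_const.min hu.measurable)
  · intro t x
    exact abs_le.2 ⟨le_max_left _ _, max_le (by linarith) (min_le_left _ _)⟩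
  · intro t ht x
    simp only [hu', hu.periodic t ht x]
  · intro ψ hψ hψp t ht
    have h := hu.weak (fun _ => ψ) (hψ.comp contDiff_snd) (fun _ => hψp) t ht
    simp only [deriv_const, mul_zero, zero_add] at h
    have e1 : ∫ x in (-π)..π, u' t x * ψ x = ∫ x in (-π)..π, u t x * ψ x :=
      intervalIntegral.integral_congr_ae (by filter_upwards [hae t ht] with x hx _; rw [hx])
    rw [e1, h]
    congr 1
    refine intervalIntegral.integral_congr fun s hs => ?_
    rw [Set.uIcc_of_le ht] at hs
    exact intervalIntegral.integral_congr_ae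
      (by filter_upwards [hae s hs.1] with x hx _; rw [hx])
  · intro t ht z hz
    have h1 : ∀ᵐ x, u' t (x + z) = u t (x + z) :=
      (measurePreserving_add_right volume z).quasiMeasurePreserving.ae (hae t ht.le)
    filter_upwards [hC t ht z hz, hae t ht.le, h1] with x a1 a2 a3
    rw [a2, a3]; exact a1

open MeasureTheory in
/-- Uniqueness of entropy solutions of the Burgers equation. -/
theorem IsBurgersEntropySolution.ae_eq {g : ℝ → ℝ} {u v : ℝ → ℝ → ℝ}
    (hu : IsBurgersEntropySolution g u) (hv : IsBurgersEntropySolution g v) {T : ℝ} (hT : 0 ≤ T) :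
    ∀ᵐ x ∂volume.restrict (Set.Ioc (-π) π), u T x = v T x := by
  obtain ⟨u', M, C, hC0, hum, huM, hup, hue, huw, huo⟩ := hu.exists_bounded
  obtain ⟨v', N, D, hD0, hvm, hvN, hvp, hve, hvw, hvo⟩ := hv.exists_bounded
  have hle : -π ≤ π := by linarith [Real.pi_pos]
  have key := eq_of_weak_of_oleinik (M := max M N) (C := (C + D) / 2) hum hvm
    (fun t x => (huM t x).trans (le_max_left _ _)) (fun t x => (hvN t x).trans (le_max_right _ _))
    (by linarith) hup hvp ?_ ?_ hT
  · filter_upwards [key, ae_restrict_of_ae (hue T hT), ae_restrict_of_ae (hve T hT)] with x a1 a2 a3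
    rw [← a2, ← a3, a1]
  · intro ψ hψ hψp t ht
    have hψ' : Continuous (deriv ψ) := hψ.continuous_deriv (by norm_num)
    obtain ⟨K, hK⟩ := (isCompact_Icc (a := -π) (b := π)).exists_bound_of_continuousOn
      hψ'.continuousOn
    have hslice : ∀ {f : ℝ → ℝ → ℝ}, Measurable (Function.uncurry f) → ∀ t, Measurable (f t) :=
      fun hf t => hf.comp measurable_prodMk_left
    -- the flux integrals are integrable in time
    have hI : ∀ {f : ℝ → ℝ → ℝ} {M : ℝ}, Measurable (Function.uncurry f) →
        (∀ t x, |f t x| ≤ M) →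
        IntervalIntegrable (fun s => ∫ x in (-π)..π, f s x ^ 2 / 2 * deriv ψ x) volume 0 t := by
      intro f M hf hfM
      have h : IntegrableOn (Function.uncurry fun s x => f s x ^ 2 / 2 * deriv ψ x)
          (Set.uIoc 0 t ×ˢ Set.uIoc (-π) π) := by
        refine integrable_prod_of_bound (K := M ^ 2 / 2 * K) ?_ ?_
        · exact ((hf.pow_const 2).div_const 2).mul (hψ'.measurable.comp measurable_snd)
        · intro s _ x hx
          rw [Set.uIoc_of_le hle] at hx
          have h1 := pow_le_pow_left₀ (abs_nonneg _) (hfM s x) 2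
          have h2 := hK x ⟨hx.1.le, hx.2⟩
          rw [Real.norm_eq_abs] at h2
          rw [abs_mul, abs_div, abs_pow, abs_two]
          gcongr
      rw [IntegrableOn, Measure.volume_eq_prod, ← Measure.prod_restrict] at h
      have h2 := h.integral_prod_left
      rw [intervalIntegrable_iff]
      refine h2.congr (ae_of_all _ fun s => ?_)
      simp only [intervalIntegral.integral_of_le hle, Set.uIoc_of_le hle, Function.uncurry]
    have hsq : ∀ {f : ℝ → ℝ → ℝ} {M : ℝ}, Measurable (Function.uncurry f) →
        (∀ t x, |f t x| ≤ M) → ∀ s,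
        IntervalIntegrable (fun x => f s x ^ 2 / 2 * deriv ψ x) volume (-π) π := by
      intro f M hf hfM s
      refine intervalIntegrable_bdd_mul (M := M ^ 2 / 2) (((hslice hf s).pow_const 2).div_const 2)
        (fun x => ?_) hψ' _ _
      have h1 := pow_le_pow_left₀ (abs_nonneg _) (hfM s x) 2
      rw [abs_div, abs_pow, abs_two]
      gcongr
    simp_rw [sub_mul]
    rw [intervalIntegral.integral_sub
      (intervalIntegrable_bdd_mul (hslice hum t) (huM t) hψ.continuous _ _)
      (intervalIntegrable_bdd_mul (hslice hvm t) (hvN t) hψ.continuous _ _),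
      huw ψ hψ hψp t ht, hvw ψ hψ hψp t ht, add_sub_add_left_eq_sub,
      ← intervalIntegral.integral_sub (hI hum huM) (hI hvm hvN)]
    refine intervalIntegral.integral_congr fun s _ => ?_
    rw [← intervalIntegral.integral_sub (hsq hum huM s) (hsq hvm hvN s)]
    refine intervalIntegral.integral_congr fun x _ => ?_
    ring
  · intro t ht z hz
    filter_upwards [huo t ht z hz, hvo t ht z hz] with x a1 a2
    linarith

/-! ### Characteristics of the sine wave -/

/-- The position at time `t` of the characteristic of the initial datum `-sin` issued from `y`. -/
noncomputable def charMap (t y : ℝ) : ℝ := y - t * Real.sin y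

/-- The starting points in `(0, 2π)` of the characteristics which at time `t` have not been
absorbed by one of the shocks at `0` and `2π`. -/
def aliveSet (t : ℝ) : Set ℝ := {y | y ∈ Set.Ioo 0 (2 * π) ∧ charMap t y ∈ Set.Ioo 0 (2 * π)}

theorem charMap_reflect (t y : ℝ) : charMap t (2 * π - y) = 2 * π - charMap t y := by
  simp only [charMap, Real.sin_two_pi_sub]; ring

theorem reflect_mem_aliveSet {t y : ℝ} : 2 * π - y ∈ aliveSet t ↔ y ∈ aliveSet t := by
  simp only [aliveSet, Set.mem_ofPred_eq, Set.mem_Ioo, charMap_reflect]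
  constructor <;> rintro ⟨⟨h1, h2⟩, h3, h4⟩ <;>
    exact ⟨⟨by linarith, by linarith⟩, by linarith, by linarith⟩

theorem hasDerivAt_charMap (t y : ℝ) : HasDerivAt (charMap t) (1 - t * Real.cos y) y := by
  exact (hasDerivAt_id y).sub ((Real.hasDerivAt_sin y).const_mul t)

theorem continuous_charMap (t : ℝ) : Continuous (charMap t) := by
  unfold charMap; fun_prop

theorem one_sub_mul_cos_pos {t y : ℝ} (ht : 0 ≤ t) (hy : y ∈ aliveSet t) :
    0 < 1 - t * Real.cos y := by
  -- the left half of the period, from which the right half follows by reflection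
  have key : ∀ y ∈ aliveSet t, y ≤ π → 0 < 1 - t * Real.cos y := by
    intro y hy hyπ
    obtain ⟨⟨h1, h2⟩, h3, h4⟩ := hy
    rcases le_or_gt (Real.cos y) 0 with hc | hc
    · nlinarith
    · have hy2 : y < π / 2 := by
        by_contra hcon
        exact absurd (Real.cos_nonpos_of_pi_div_two_le_of_le (not_lt.1 hcon) (by linarith))
          (not_le.2 hc)
      have hs : 0 < Real.sin y := Real.sin_pos_of_pos_of_lt_pi h1 (by linarith [Real.pi_pos])
      have h5 := Real.lt_tan h1 hy2
      rw [Real.tan_eq_sin_div_cos, lt_div_iff₀ hc] at h5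
      have h6 : t * Real.sin y < y := by simp only [charMap] at h3; linarith
      have h7 : t * Real.cos y * Real.sin y < 1 * Real.sin y := by nlinarith
      linarith [lt_of_mul_lt_mul_right h7 hs.le]
  rcases le_total y π with h | h
  · exact key y hy h
  · have := key (2 * π - y) (reflect_mem_aliveSet.2 hy) (by linarith)
    rwa [Real.cos_two_pi_sub] at this

/-- In the left half of the period, characteristics are absorbed in the order of their
starting points. -/
theorem charMap_pos_of_lt {t y₁ y₂ : ℝ} (ht : 0 ≤ t) (h1 : 0 < y₁) (h12 : y₁ < y₂) (h2 : y₂ ≤ π)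
    (h : 0 ≤ charMap t y₁) : 0 < charMap t y₂ := by
  rcases ht.eq_or_lt with rfl | ht
  · simp only [charMap]; linarith
  have hy2 : 0 < y₂ := h1.trans h12
  have hw : 0 < 1 - y₁ / y₂ := by rw [sub_pos, div_lt_one hy2]; exact h12
  have hc := strictConcaveOn_sin_Icc.2 (⟨le_rfl, Real.pi_pos.le⟩ : (0 : ℝ) ∈ Set.Icc 0 π)
    (⟨hy2.le, h2⟩ : y₂ ∈ Set.Icc 0 π) hy2.ne hw (div_pos h1 hy2) (by ring)
  simp only [smul_eq_mul, mul_zero, zero_add, Real.sin_zero] at hc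
  rw [div_mul_cancel₀ _ hy2.ne', div_mul_eq_mul_div, div_lt_iff₀ hy2] at hc
  simp only [charMap] at h ⊢
  have h3 : y₁ * (t * Real.sin y₂) < y₁ * y₂ := by nlinarith
  linarith [lt_of_mul_lt_mul_left h3 h1.le]

theorem mem_aliveSet_iff_of_le_pi {t y : ℝ} (ht : 0 ≤ t) (hy : 0 < y) (hyπ : y ≤ π) :
    y ∈ aliveSet t ↔ 0 < charMap t y := by
  have hπ := Real.pi_pos
  refine ⟨fun h => h.2.1, fun h => ⟨⟨hy, by linarith⟩, h, ?_⟩⟩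
  have := Real.sin_nonneg_of_nonneg_of_le_pi hy.le hyπ
  simp only [charMap]
  nlinarith

/-- The characteristics alive at time `t` form an interval, whose left endpoint has just reached
the shock at `0`. -/
theorem exists_aliveSet_eq_Ioo {t : ℝ} (ht : 0 ≤ t) :
    ∃ a, 0 ≤ a ∧ a < π ∧ charMap t a = 0 ∧ aliveSet t = Set.Ioo a (2 * π - a) := by
  have hπ := Real.pi_pos
  have hcomp : IsCompact (Set.Icc 0 π ∩ {y | charMap t y ≤ 0}) :=
    isCompact_Icc.inter_right (isClosed_le (continuous_charMap t) continuous_const)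
  obtain ⟨a, ⟨⟨ha0, haπ⟩, hale⟩, hmax⟩ := hcomp.exists_isGreatest
    ⟨0, ⟨le_rfl, hπ.le⟩, by simp [charMap]⟩
  have hpos : ∀ y, a < y → y ≤ π → 0 < charMap t y := by
    intro y hy hyπ
    by_contra hcon
    exact absurd (hmax ⟨⟨ha0.trans hy.le, hyπ⟩, not_lt.1 hcon⟩) (not_le.2 hy)
  have haπ' : a < π := by
    refine lt_of_le_of_ne haπ ?_
    rintro rfl
    simp only [charMap, Set.mem_ofPred_eq, Real.sin_pi, mul_zero, sub_zero] at hale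
    linarith
  have ha : charMap t a = 0 := by
    refine le_antisymm hale ?_
    refine ge_of_tendsto (x := nhdsWithin a (Set.Ioi a))
      ((continuous_charMap t).continuousAt.tendsto.mono_left nhdsWithin_le_nhds) ?_
    filter_upwards [Ioo_mem_nhdsGT haπ'] with y hy
    exact (hpos y hy.1 hy.2.le).le
  refine ⟨a, ha0, haπ', ha, ?_⟩
  have half : ∀ y, y ≤ π → (y ∈ aliveSet t ↔ a < y) := by
    intro y hy
    constructor
    · intro h
      by_contra hcon
      rcases (not_lt.1 hcon).eq_or_lt with rfl | hlt
      · exact absurd h.2.1 (by rw [ha]; exact lt_irrefl _)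
      · have := charMap_pos_of_lt ht h.1.1 hlt haπ h.2.1.le
        linarith
    · intro h
      exact (mem_aliveSet_iff_of_le_pi ht (ha0.trans_lt h) hy).2 (hpos y h hy)
  ext y
  rcases le_total y π with h | h
  · rw [half y h, Set.mem_Ioo]
    exact ⟨fun h' => ⟨h', by linarith⟩, fun h' => h'.1⟩
  · rw [← reflect_mem_aliveSet, half _ (by linarith), Set.mem_Ioo]
    exact ⟨fun h' => ⟨by linarith, by linarith⟩, fun h' => by linarith [h'.2]⟩

theorem measurableSet_aliveSet {t : ℝ} (ht : 0 ≤ t) : MeasurableSet (aliveSet t) := by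
  obtain ⟨a, -, -, -, h⟩ := exists_aliveSet_eq_Ioo ht
  rw [h]; exact measurableSet_Ioo

theorem strictMonoOn_charMap {t : ℝ} (ht : 0 ≤ t) : StrictMonoOn (charMap t) (aliveSet t) := by
  obtain ⟨a, -, -, -, h⟩ := exists_aliveSet_eq_Ioo ht
  refine strictMonoOn_of_deriv_pos ?_ (continuous_charMap t).continuousOn fun y hy => ?_
  · rw [h]; exact convex_Ioo _ _
  · rw [(hasDerivAt_charMap t y).deriv]
    exact one_sub_mul_cos_pos ht (interior_subset hy)

theorem image_charMap_aliveSet {t : ℝ} (ht : 0 ≤ t) :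
    charMap t '' aliveSet t = Set.Ioo 0 (2 * π) := by
  obtain ⟨a, ha0, haπ, ha, h⟩ := exists_aliveSet_eq_Ioo ht
  refine Set.Subset.antisymm ?_ ?_
  · rintro _ ⟨y, hy, rfl⟩
    exact hy.2
  · have h1 := intermediate_value_Ioo (f := charMap t) (a := a) (b := 2 * π - a) (by linarith)
      (continuous_charMap t).continuousOn
    rw [charMap_reflect, ha, sub_zero, ← h] at h1
    exact h1

open Classical in
/-- The starting point of the characteristic which arrives at time `t ≥ 0` at `x ∈ (0, 2π)`, and
`0` for other `t` and `x`. -/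
noncomputable def charFoot (t x : ℝ) : ℝ :=
  if h : 0 ≤ t ∧ x ∈ Set.Ioo 0 (2 * π) then
    ((image_charMap_aliveSet h.1).symm ▸ h.2 : x ∈ charMap t '' aliveSet t).choose
  else 0

theorem charFoot_spec {t x : ℝ} (ht : 0 ≤ t) (hx : x ∈ Set.Ioo 0 (2 * π)) :
    charFoot t x ∈ aliveSet t ∧ charMap t (charFoot t x) = x := by
  have h : 0 ≤ t ∧ x ∈ Set.Ioo 0 (2 * π) := ⟨ht, hx⟩
  rw [charFoot, dif_pos h]
  exact ((image_charMap_aliveSet h.1).symm ▸ h.2 : x ∈ charMap t '' aliveSet t).choose_spec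

theorem charFoot_of_not {t x : ℝ} (h : ¬ (0 ≤ t ∧ x ∈ Set.Ioo 0 (2 * π))) : charFoot t x = 0 := by
  rw [charFoot, dif_neg h]

theorem charFoot_charMap {t y : ℝ} (ht : 0 ≤ t) (hy : y ∈ aliveSet t) :
    charFoot t (charMap t y) = y := by
  obtain ⟨h1, h2⟩ := charFoot_spec ht hy.2
  exact (strictMonoOn_charMap ht).injOn h1 hy h2

theorem charFoot_nonneg (t x : ℝ) : 0 ≤ charFoot t x := by
  by_cases h : 0 ≤ t ∧ x ∈ Set.Ioo 0 (2 * π)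
  · exact (charFoot_spec h.1 h.2).1.1.1.le
  · rw [charFoot_of_not h]

theorem charFoot_lt (t x : ℝ) : charFoot t x < 2 * π := by
  by_cases h : 0 ≤ t ∧ x ∈ Set.Ioo 0 (2 * π)
  · exact (charFoot_spec h.1 h.2).1.1.2
  · rw [charFoot_of_not h]; linarith [Real.pi_pos]

/-- The characteristic issued from `c` separates positions according to their feet, even after
it has been absorbed by a shock. -/
theorem charFoot_lt_iff {t x c : ℝ} (ht : 0 ≤ t) (hx : x ∈ Set.Ioo 0 (2 * π))
    (hc : c ∈ Set.Ioo 0 (2 * π)) : charFoot t x < c ↔ x < charMap t c := by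
  obtain ⟨h1, h2⟩ := charFoot_spec ht hx
  by_cases hcA : c ∈ aliveSet t
  · rw [← (strictMonoOn_charMap ht).lt_iff_lt h1 hcA, h2]
  obtain ⟨a, ha0, haπ, ha, h⟩ := exists_aliveSet_eq_Ioo ht
  rw [h] at h1 hcA
  rcases le_total c π with hcπ | hcπ
  · have hca : c ≤ a := by
      by_contra hcon
      exact hcA ⟨not_le.1 hcon, by linarith⟩
    have h3 : charMap t c ≤ 0 := by
      by_contra hcon
      have : c ∈ aliveSet t := (mem_aliveSet_iff_of_le_pi ht hc.1 hcπ).2 (not_le.1 hcon)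
      rw [h] at this
      exact hcA this
    exact ⟨fun h' => by linarith [h1.1], fun h' => by linarith [hx.1]⟩
  · have hca : 2 * π - a ≤ c := by
      by_contra hcon
      exact hcA ⟨by linarith, not_le.1 hcon⟩
    have h3 : charMap t (2 * π - c) ≤ 0 := by
      by_contra hcon
      have : 2 * π - c ∈ aliveSet t :=
        (mem_aliveSet_iff_of_le_pi ht (by linarith [hc.2]) (by linarith)).2 (not_le.1 hcon)
      rw [reflect_mem_aliveSet, h] at this
      exact hcA this
    rw [charMap_reflect] at h3
    exact ⟨fun h' => by linarith [hx.2], fun h' => by linarith [h1.2]⟩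

theorem charFoot_mono {t x x' : ℝ} (h : x ≤ x') (h2 : x' < 2 * π) :
    charFoot t x ≤ charFoot t x' := by
  by_cases hx : 0 ≤ t ∧ x ∈ Set.Ioo 0 (2 * π)
  · have hx' : x' ∈ Set.Ioo 0 (2 * π) := ⟨hx.2.1.trans_le h, h2⟩
    by_contra hcon
    obtain ⟨h3, h4⟩ := charFoot_spec hx.1 hx.2
    rw [not_le, charFoot_lt_iff hx.1 hx' h3.1, h4] at hcon
    linarith
  · rw [charFoot_of_not hx]; exact charFoot_nonneg _ _

theorem measurable_charFoot : Measurable (Function.uncurry charFoot) := by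
  refine measurable_of_Iio fun c => ?_
  have hdom : MeasurableSet {p : ℝ × ℝ | 0 ≤ p.1 ∧ p.2 ∈ Set.Ioo 0 (2 * π)} :=
    (measurableSet_le measurable_const measurable_fst).inter (measurable_snd measurableSet_Ioo)
  rcases le_or_gt c 0 with hc | hc
  · convert MeasurableSet.empty
    ext ⟨t, x⟩
    simp only [Set.mem_preimage, Function.uncurry, Set.mem_Iio, Set.mem_empty_iff_false, iff_false,
      not_lt]
    exact hc.trans (charFoot_nonneg _ _)
  rcases le_or_gt (2 * π) c with hc2 | hc2
  · convert MeasurableSet.univ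
    ext ⟨t, x⟩
    simp only [Set.mem_preimage, Function.uncurry, Set.mem_Iio, Set.mem_univ, iff_true]
    exact (charFoot_lt _ _).trans_le hc2
  · have hset : Function.uncurry charFoot ⁻¹' Set.Iio c =
        {p : ℝ × ℝ | 0 ≤ p.1 ∧ p.2 ∈ Set.Ioo 0 (2 * π)}ᶜ ∪ {p : ℝ × ℝ | p.2 < charMap p.1 c} := by
      ext ⟨t, x⟩
      simp only [Set.mem_preimage, Function.uncurry, Set.mem_Iio, Set.mem_union, Set.mem_compl_iff,
        Set.mem_ofPred_eq]
      by_cases h : 0 ≤ t ∧ x ∈ Set.Ioo 0 (2 * π)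
      · rw [charFoot_lt_iff h.1 h.2 ⟨hc, hc2⟩]
        simp [h]
      · simp only [charFoot_of_not h, h, hc, not_false_eq_true, true_or]
    rw [hset]
    refine hdom.compl.union (measurableSet_lt measurable_snd ?_)
    unfold charMap
    fun_prop

open MeasureTheory in
/-- Change of variables along the characteristics. -/
theorem integral_charFoot {t : ℝ} (ht : 0 ≤ t) (G : ℝ → ℝ → ℝ) :
    ∫ x in Set.Ioo 0 (2 * π), G (charFoot t x) x =
      ∫ y in aliveSet t, (1 - t * Real.cos y) * G y (charMap t y) := by
  rw [← image_charMap_aliveSet ht, integral_image_eq_integral_abs_deriv_smul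
    (measurableSet_aliveSet ht) (fun y _ => (hasDerivAt_charMap t y).hasDerivWithinAt)
    (strictMonoOn_charMap ht).injOn]
  refine setIntegral_congr_fun (measurableSet_aliveSet ht) fun y hy => ?_
  simp only [charFoot_charMap ht hy, abs_of_pos (one_sub_mul_cos_pos ht hy), smul_eq_mul]

/-! ### Existence of the entropy solution -/

theorem integral_eq_integral_add_reflect {h : ℝ → ℝ}
    (hh : IntervalIntegrable h MeasureTheory.volume 0 (2 * π)) :
    ∫ y in (0 : ℝ)..(2 * π), h y = ∫ y in (0 : ℝ)..π, (h y + h (2 * π - y)) := by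
  have hπ := Real.pi_pos
  have h1 : IntervalIntegrable h MeasureTheory.volume 0 π :=
    hh.mono_set (by
      rw [Set.uIcc_of_le hπ.le, Set.uIcc_of_le (by linarith)]
      exact Set.Icc_subset_Icc_right (by linarith))
  have h2 : IntervalIntegrable h MeasureTheory.volume π (2 * π) :=
    hh.mono_set (by
      rw [Set.uIcc_of_le (by linarith), Set.uIcc_of_le (by linarith)]
      exact Set.Icc_subset_Icc_left hπ.le)
  have h3 : IntervalIntegrable (fun y => h (2 * π - y)) MeasureTheory.volume 0 π := by
    have := (h2.comp_sub_left (2 * π)).symm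
    rwa [sub_self, show 2 * π - π = π by ring] at this
  rw [intervalIntegral.integral_add h1 h3, intervalIntegral.integral_comp_sub_left, sub_zero,
    show 2 * π - π = π by ring, intervalIntegral.integral_add_adjacent_intervals h1 h2]

open MeasureTheory in
/-- Integrating a time derivative over the region swept out by the alive characteristics: the
contributions of the two sides of the shock cancel when the densities `P` there are opposite. -/
theorem integral_deriv_aliveSet {P P' : ℝ → ℝ → ℝ} (hP : Continuous (Function.uncurry P))
    (hP' : Continuous (Function.uncurry P'))
    (hd : ∀ s y, HasDerivAt (fun r => P r y) (P' s y) s)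
    (hodd : ∀ s y, charMap s y = 0 → P s y + P s (2 * π - y) = 0) {t : ℝ} (ht : 0 ≤ t) :
    ∫ s in (0 : ℝ)..t, ∫ y in aliveSet s, P' s y =
      (∫ y in aliveSet t, P t y) - ∫ y in (0 : ℝ)..(2 * π), P 0 y := by
  classical
  have hπ := Real.pi_pos
  have h2π : (0 : ℝ) ≤ 2 * π := by linarith
  have hR : MeasurableSet {p : ℝ × ℝ | p.2 ∈ aliveSet p.1} := by
    have hc : Measurable fun p : ℝ × ℝ => charMap p.1 p.2 := by
      unfold charMap; fun_prop
    exact (measurable_snd measurableSet_Ioo).inter (hc measurableSet_Ioo)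
  have hA : ∀ s, MeasurableSet (aliveSet s) := fun s => hR.preimage measurable_prodMk_left
  have hset : ∀ (f : ℝ → ℝ) (s : ℝ), ∫ y in aliveSet s, f y =
      ∫ y in (0 : ℝ)..(2 * π), (aliveSet s).indicator f y := by
    intro f s
    rw [intervalIntegral.integral_of_le h2π, setIntegral_indicator (hA s)]
    have hsub : aliveSet s ⊆ Set.Ioc 0 (2 * π) := fun y hy => ⟨hy.1.1, hy.1.2.le⟩
    rw [Set.inter_eq_right.2 hsub]
  have hbdd : ∀ {f : ℝ → ℝ → ℝ}, Continuous (Function.uncurry f) →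
      ∃ K, ∀ s ∈ Set.Icc 0 t, ∀ y ∈ Set.Icc 0 (2 * π), |f s y| ≤ K := by
    intro f hf
    obtain ⟨K, hK⟩ := ((isCompact_Icc (a := 0) (b := t)).prod
      (isCompact_Icc (a := 0) (b := 2 * π))).exists_bound_of_continuousOn hf.continuousOn
    exact ⟨K, fun s hs y hy => hK (s, y) ⟨hs, hy⟩⟩
  obtain ⟨K, hK⟩ := hbdd hP
  obtain ⟨K', hK'⟩ := hbdd hP'
  set F : ℝ → ℝ → ℝ := fun s y => (aliveSet s).indicator (P' s) y with hF
  have hFm : Measurable (Function.uncurry F) := by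
    have : Function.uncurry F =
        {p : ℝ × ℝ | p.2 ∈ aliveSet p.1}.indicator (Function.uncurry P') := by
      ext ⟨s, y⟩
      simp only [hF, Function.uncurry, Set.indicator, Set.mem_ofPred_eq]
    rw [this]
    exact hP'.measurable.indicator hR
  have hFI : IntegrableOn (Function.uncurry F) (Set.uIoc 0 t ×ˢ Set.uIoc 0 (2 * π)) := by
    refine integrable_prod_of_bound (K := K') hFm fun s hs y hy => ?_
    rw [Set.uIoc_of_le ht] at hs
    rw [Set.uIoc_of_le h2π] at hy
    have h1 := hK' s ⟨hs.1.le, hs.2⟩ y ⟨hy.1.le, hy.2⟩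
    simp only [hF, Set.indicator]
    split_ifs
    · exact h1
    · rw [abs_zero]; exact (abs_nonneg _).trans h1
  have hJI : IntervalIntegrable (fun y => ∫ s in (0 : ℝ)..t, F s y) volume 0 (2 * π) := by
    have h := hFI
    rw [IntegrableOn, Measure.volume_eq_prod, ← Measure.prod_restrict] at h
    have h2 := h.integral_prod_right
    rw [intervalIntegrable_iff]
    refine h2.congr (ae_of_all _ fun s => ?_)
    simp only [intervalIntegral.integral_of_le ht, Set.uIoc_of_le ht, Function.uncurry]
  have hPt : ∀ s, Continuous (P s) := fun s => hP.comp (by fun_prop : Continuous fun y => (s, y))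
  have h1I : IntervalIntegrable ((aliveSet t).indicator (P t)) volume 0 (2 * π) := by
    have := (hPt t).intervalIntegrable (μ := volume) 0 (2 * π)
    rw [intervalIntegrable_iff] at this ⊢
    exact this.indicator (hA t)
  have h0I : IntervalIntegrable (P 0) volume 0 (2 * π) := (hPt 0).intervalIntegrable _ _
  simp_rw [hset]
  rw [intervalIntegral_intervalIntegral_swap hFI, ← intervalIntegral.integral_sub h1I h0I,
    integral_eq_integral_add_reflect hJI, integral_eq_integral_add_reflect (h1I.sub h0I)]
  rw [intervalIntegral.integral_of_le hπ.le, intervalIntegral.integral_of_le hπ.le,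
    ← restrict_Ioo_eq_restrict_Ioc]
  refine setIntegral_congr_fun measurableSet_Ioo fun y hy => ?_
  have hsin : 0 < Real.sin y := Real.sin_pos_of_pos_of_lt_pi hy.1 hy.2
  set τ : ℝ := y / Real.sin y with hτ
  have hτ0 : 0 < τ := div_pos hy.1 hsin
  have halive : ∀ s, 0 ≤ s → (y ∈ aliveSet s ↔ s < τ) := by
    intro s hs
    rw [mem_aliveSet_iff_of_le_pi hs hy.1 hy.2.le, charMap, sub_pos, hτ, lt_div_iff₀ hsin]
  have halive' : ∀ s, 0 ≤ s → (2 * π - y ∈ aliveSet s ↔ s < τ) := fun s hs => by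
    rw [reflect_mem_aliveSet, halive s hs]
  have hS : ∀ c, 0 ≤ c → (∫ s in (0 : ℝ)..c, (P' s y + P' s (2 * π - y))) =
      (P c y + P c (2 * π - y)) - (P 0 y + P 0 (2 * π - y)) := by
    intro c hc
    refine intervalIntegral.integral_eq_sub_of_hasDerivAt
      (f := fun s => P s y + P s (2 * π - y)) (fun s _ => (hd s y).add (hd s _)) ?_
    have h1 : Continuous fun s : ℝ => P' s y := hP'.comp (by fun_prop : Continuous fun s => (s, y))
    have h2 : Continuous fun s : ℝ => P' s (2 * π - y) :=
      hP'.comp (by fun_prop : Continuous fun s => (s, 2 * π - y))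
    exact (h1.add h2).intervalIntegrable _ _
  have hFz : ∀ z ∈ Set.Ioo 0 (2 * π), IntervalIntegrable (fun s => F s z) volume 0 t := by
    intro z hz
    rw [intervalIntegrable_iff]
    refine Measure.integrableOn_of_bounded (M := K') (by simp [Set.uIoc])
      (hFm.comp measurable_prodMk_right).aestronglyMeasurable ?_
    refine (ae_restrict_iff' measurableSet_uIoc).2 (ae_of_all _ fun s hs => ?_)
    rw [Set.uIoc_of_le ht] at hs
    have h1 := hK' s ⟨hs.1.le, hs.2⟩ z ⟨hz.1.le, hz.2.le⟩
    simp only [hF, Set.indicator]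
    split_ifs
    · exact h1
    · rw [norm_zero]; exact (abs_nonneg _).trans h1
  have hJ : (∫ s in (0 : ℝ)..t, F s y) + ∫ s in (0 : ℝ)..t, F s (2 * π - y) =
      ∫ s in (0 : ℝ)..t, (if s < τ then P' s y + P' s (2 * π - y) else 0) := by
    rw [← intervalIntegral.integral_add (hFz y ⟨hy.1, by linarith [hy.2]⟩)
      (hFz _ ⟨by linarith [hy.2], by linarith [hy.1]⟩)]
    refine intervalIntegral.integral_congr fun s hs => ?_
    rw [Set.uIcc_of_le ht] at hs
    simp only [hF, Set.indicator, halive s hs.1, halive' s hs.1]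
    split_ifs <;> simp
  simp only [hJ, Set.indicator, halive t ht, halive' t ht]
  split_ifs with htτ
  · have e1 : ∫ s in (0 : ℝ)..t, (if s < τ then P' s y + P' s (2 * π - y) else 0) =
        ∫ s in (0 : ℝ)..t, (P' s y + P' s (2 * π - y)) := by
      refine intervalIntegral.integral_congr fun s hs => ?_
      rw [Set.uIcc_of_le ht] at hs
      simp only [if_pos (hs.2.trans_lt htτ)]
    rw [e1, hS t ht]
    ring
  · have htτ' := not_lt.1 htτ
    have e1 : ∫ s in (0 : ℝ)..t, (if s < τ then P' s y + P' s (2 * π - y) else 0) =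
        ∫ s in (0 : ℝ)..τ, (P' s y + P' s (2 * π - y)) := by
      have e2 : (fun s => if s < τ then P' s y + P' s (2 * π - y) else 0) =
          (Set.Iio τ).indicator fun s => P' s y + P' s (2 * π - y) := by
        ext s; simp only [Set.indicator, Set.mem_Iio]
      have e3 : Set.Ioc 0 t ∩ Set.Iio τ = Set.Ioo 0 τ := by
        ext s
        simp only [Set.mem_inter_iff, Set.mem_Ioc, Set.mem_Iio, Set.mem_Ioo]
        exact ⟨fun h => ⟨h.1.1, h.2⟩, fun h => ⟨⟨h.1, h.2.le.trans htτ'⟩, h.2⟩⟩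
      rw [intervalIntegral.integral_of_le ht, intervalIntegral.integral_of_le hτ0.le, e2,
        setIntegral_indicator measurableSet_Iio, e3, restrict_Ioo_eq_restrict_Ioc]
    rw [e1, hS τ hτ0.le, hodd τ y (by simp only [charMap, hτ]; field_simp; ring)]
    ring

/-- The entropy solution with initial datum `-sin`, constant along alive characteristics. -/
noncomputable def sineSol (t x : ℝ) : ℝ :=
  -Real.sin (charFoot t (2 * π * Int.fract (x / (2 * π))))

theorem fract_period_mem (x : ℝ) : 0 ≤ 2 * π * Int.fract (x / (2 * π)) ∧
    2 * π * Int.fract (x / (2 * π)) < 2 * π := by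
  have hπ : 0 < 2 * π := by linarith [Real.pi_pos]
  exact ⟨mul_nonneg hπ.le (Int.fract_nonneg _),
    by nlinarith [Int.fract_lt_one (x / (2 * π))]⟩

theorem sineSol_periodic (t : ℝ) : Function.Periodic (sineSol t) (2 * π) := by
  intro x
  have : (x + 2 * π) / (2 * π) = x / (2 * π) + 1 := by
    have := Real.pi_ne_zero
    field_simp
  simp only [sineSol, this, Int.fract_add_one]

theorem sineSol_of_mem {t x : ℝ} (hx : x ∈ Set.Ioo 0 (2 * π)) :
    sineSol t x = -Real.sin (charFoot t x) := by
  have hπ : 0 < 2 * π := by linarith [Real.pi_pos]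
  have : Int.fract (x / (2 * π)) = x / (2 * π) :=
    Int.fract_eq_self.2 ⟨div_nonneg hx.1.le hπ.le, (div_lt_one hπ).2 hx.2⟩
  rw [sineSol, this, mul_div_cancel₀ _ hπ.ne']

theorem measurable_sineSol : Measurable (Function.uncurry sineSol) := by
  have h : Measurable fun p : ℝ × ℝ => (p.1, 2 * π * Int.fract (p.2 / (2 * π))) := by
    fun_prop
  exact (Real.measurable_sin.comp (measurable_charFoot.comp h)).neg

/-- Oleinik's condition: `t u = x - ξ(t, x)`, where the foot `ξ` is nondecreasing in `x`. -/
theorem sineSol_oleinik {t z x : ℝ} (ht : 0 < t) (hz : 0 < z) :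
    sineSol t (x + z) - sineSol t x ≤ z / t := by
  have hπ : 0 < 2 * π := by linarith [Real.pi_pos]
  set r : ℝ → ℝ := fun x => 2 * π * Int.fract (x / (2 * π)) with hr
  have hrx : ∀ x, x = 2 * π * ⌊x / (2 * π)⌋ + r x := by
    intro x
    simp only [hr, Int.fract]
    field_simp
    ring
  have hfoot : ∀ x, t * sineSol t x = r x - charFoot t (r x) := by
    intro x
    by_cases h : r x ∈ Set.Ioo 0 (2 * π)
    · have h2 := (charFoot_spec ht.le h).2
      simp only [charMap] at h2
      simp only [sineSol]
      linarith
    · have h0 : r x = 0 := by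
        obtain ⟨h1, h2⟩ := fract_period_mem x
        by_contra hne
        exact h ⟨lt_of_le_of_ne h1 (Ne.symm hne), h2⟩
      have h1 : charFoot t 0 = 0 := charFoot_of_not (by simp)
      have h2 : sineSol t x = -Real.sin (charFoot t (r x)) := rfl
      rw [h2, h0, h1]
      simp
  have hmono : 2 * π * ⌊x / (2 * π)⌋ + charFoot t (r x) ≤
      2 * π * ⌊(x + z) / (2 * π)⌋ + charFoot t (r (x + z)) := by
    have hle : ⌊x / (2 * π)⌋ ≤ ⌊(x + z) / (2 * π)⌋ := by
      apply Int.floor_le_floor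
      gcongr
      linarith
    rcases hle.eq_or_lt with h | h
    · have h1 : r x ≤ r (x + z) := by
        have e1 := hrx x
        have e2 := hrx (x + z)
        rw [h] at e1
        linarith
      rw [h]
      have := charFoot_mono (t := t) h1 (fract_period_mem (x + z)).2
      linarith
    · have h1 : ((⌊x / (2 * π)⌋ : ℤ) : ℝ) + 1 ≤ ⌊(x + z) / (2 * π)⌋ := by exact_mod_cast h
      have h2 := charFoot_lt t (r x)
      have h3 := charFoot_nonneg t (r (x + z))
      nlinarith
  rw [le_div_iff₀ ht]
  have e1 := hrx x
  have e2 := hrx (x + z)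
  have e3 := hfoot x
  have e4 := hfoot (x + z)
  nlinarith

open MeasureTheory in
theorem integral_sineSol_mul {t : ℝ} (ht : 0 ≤ t) (G : ℝ → ℝ → ℝ) :
    ∫ x in (0 : ℝ)..(2 * π), G (sineSol t x) x =
      ∫ y in aliveSet t, (1 - t * Real.cos y) * G (-Real.sin y) (charMap t y) := by
  have h2π : (0 : ℝ) ≤ 2 * π := by linarith [Real.pi_pos]
  rw [intervalIntegral.integral_of_le h2π, ← restrict_Ioo_eq_restrict_Ioc,
    ← integral_charFoot ht fun y x => G (-Real.sin y) x]
  refine setIntegral_congr_fun measurableSet_Ioo fun x hx => ?_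
  simp only [sineSol_of_mem hx]

open MeasureTheory in
/-- The weak formulation. In characteristic coordinates the integrand is the divergence
`∂ₛP + ∂_yQ`, whose fluxes through the two sides of the shock cancel. -/
theorem sineSol_weak {φ : ℝ → ℝ → ℝ} (hφ : ContDiff ℝ ∞ (Function.uncurry φ))
    (hφp : ∀ t, Function.Periodic (φ t) (2 * π)) {t : ℝ} (ht : 0 ≤ t) :
    ∫ x in (0 : ℝ)..(2 * π), sineSol t x * φ t x =
      (∫ x in (0 : ℝ)..(2 * π), -Real.sin x * φ 0 x) +
        ∫ s in (0 : ℝ)..t, ∫ x in (0 : ℝ)..(2 * π),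
          (sineSol s x * deriv (fun r => φ r x) s + sineSol s x ^ 2 / 2 * deriv (φ s) x) := by
  set Φ := Function.uncurry φ with hΦ
  have hΦd : Differentiable ℝ Φ := hφ.differentiable (by norm_num)
  have hΦ' : Continuous (fderiv ℝ Φ) := hφ.continuous_fderiv (by norm_num)
  set φt : ℝ × ℝ → ℝ := fun p => fderiv ℝ Φ p (1, 0) with hφt
  set φx : ℝ × ℝ → ℝ := fun p => fderiv ℝ Φ p (0, 1) with hφx
  have hφtc : Continuous φt := hΦ'.clm_apply continuous_const
  have hφxc : Continuous φx := hΦ'.clm_apply continuous_const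
  have hcurve : ∀ {c c' : ℝ → ℝ × ℝ} {v : ℝ × ℝ} {s : ℝ}, HasDerivAt c v s →
      HasDerivAt (fun r => Φ (c r)) (v.1 * φt (c s) + v.2 * φx (c s)) s := by
    intro c _ v s hc
    have h1 := (hΦd (c s)).hasFDerivAt.comp_hasDerivAt s hc
    have h2 : v = v.1 • ((1 : ℝ), (0 : ℝ)) + v.2 • ((0 : ℝ), (1 : ℝ)) := by
      ext <;> simp
    rw [h2, map_add, map_smul, map_smul] at h1
    exact h1
  have hdt : ∀ s x, deriv (fun r => φ r x) s = φt (s, x) := by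
    intro s x
    have h := hcurve (c' := fun r => (r, x)) ((hasDerivAt_id s).prodMk (hasDerivAt_const s x))
    simp only [one_mul, zero_mul, add_zero] at h
    exact h.deriv
  have hdx : ∀ s x, deriv (φ s) x = φx (s, x) := by
    intro s x
    have h := hcurve (c' := fun r => (s, r)) ((hasDerivAt_const x s).prodMk (hasDerivAt_id x))
    simp only [one_mul, zero_mul, zero_add] at h
    exact h.deriv
  have hcm : Continuous fun p : ℝ × ℝ => (p.1, charMap p.1 p.2) := by
    unfold charMap; fun_prop
  set D : ℝ → ℝ → ℝ := fun s y => Φ (s, charMap s y) with hD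
  set Dt : ℝ → ℝ → ℝ := fun s y => φt (s, charMap s y) with hDt
  set Dx : ℝ → ℝ → ℝ := fun s y => φx (s, charMap s y) with hDx
  have hDc : Continuous (Function.uncurry D) := hφ.continuous.comp hcm
  have hDtc : Continuous (Function.uncurry Dt) := hφtc.comp hcm
  have hDxc : Continuous (Function.uncurry Dx) := hφxc.comp hcm
  have hDs : ∀ s y, HasDerivAt (fun r => D r y) (Dt s y - Real.sin y * Dx s y) s := by
    intro s y
    have h0 : HasDerivAt (fun r => charMap r y) (-Real.sin y) s := by
      simpa [charMap] using ((hasDerivAt_id s).mul_const (Real.sin y)).const_sub y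
    have h := hcurve (c' := fun r => (r, y)) ((hasDerivAt_id s).prodMk h0)
    simp only [one_mul, neg_mul] at h
    exact h
  have hDy : ∀ s y, HasDerivAt (D s) ((1 - s * Real.cos y) * Dx s y) y := by
    intro s y
    have h := hcurve (c' := fun r => (r, y))
      ((hasDerivAt_const y s).prodMk (hasDerivAt_charMap s y))
    simp only [zero_mul, zero_add] at h
    exact h
  set P : ℝ → ℝ → ℝ := fun s y => -Real.sin y * (1 - s * Real.cos y) * D s y with hP
  set P' : ℝ → ℝ → ℝ := fun s y => Real.sin y * Real.cos y * D s y -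
    Real.sin y * (1 - s * Real.cos y) * (Dt s y - Real.sin y * Dx s y) with hP'
  set Q : ℝ → ℝ → ℝ := fun s y => -(Real.sin y ^ 2 / 2) * D s y with hQ
  set Q' : ℝ → ℝ → ℝ := fun s y => -(Real.sin y * Real.cos y) * D s y -
    Real.sin y ^ 2 / 2 * ((1 - s * Real.cos y) * Dx s y) with hQ'
  have hPc : Continuous (Function.uncurry P) := by
    have : Continuous fun p : ℝ × ℝ => -Real.sin p.2 * (1 - p.1 * Real.cos p.2) := by fun_prop
    exact this.mul hDc
  have hPc' : Continuous (Function.uncurry P') := by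
    have h1 : Continuous fun p : ℝ × ℝ => Real.sin p.2 * (1 - p.1 * Real.cos p.2) := by fun_prop
    have h2 : Continuous fun p : ℝ × ℝ => Real.sin p.2 * Real.cos p.2 := by fun_prop
    have h3 : Continuous fun p : ℝ × ℝ => Real.sin p.2 := by fun_prop
    exact (h2.mul hDc).sub (h1.mul (hDtc.sub (h3.mul hDxc)))
  have hQc' : Continuous (Function.uncurry Q') := by
    have h1 : Continuous fun p : ℝ × ℝ => -(Real.sin p.2 * Real.cos p.2) := by fun_prop
    have h2 : Continuous fun p : ℝ × ℝ => 1 - p.1 * Real.cos p.2 := by fun_prop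
    have h3 : Continuous fun p : ℝ × ℝ => Real.sin p.2 ^ 2 / 2 := by fun_prop
    exact (h1.mul hDc).sub (h3.mul (h2.mul hDxc))
  have hPd : ∀ s y, HasDerivAt (fun r => P r y) (P' s y) s := by
    intro s y
    have h1 : HasDerivAt (fun r : ℝ => -Real.sin y * (1 - r * Real.cos y))
        (Real.sin y * Real.cos y) s := by
      have := (((hasDerivAt_id s).mul_const (Real.cos y)).const_sub 1).const_mul (-Real.sin y)
      simpa using this
    refine (h1.mul (hDs s y)).congr_deriv ?_
    simp only [hP']; ring
  have hQd : ∀ s y, HasDerivAt (Q s) (Q' s y) y := by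
    intro s y
    have h1 : HasDerivAt (fun y : ℝ => -(Real.sin y ^ 2 / 2)) (-(Real.sin y * Real.cos y)) y := by
      refine (((Real.hasDerivAt_sin y).pow 2).div_const 2).neg.congr_deriv ?_
      simp only [Nat.cast_ofNat, Nat.add_one_sub_one, pow_one]; ring
    refine (h1.mul (hDy s y)).congr_deriv ?_
    simp only [hQ']; ring
  have hD0 : ∀ s y, charMap s y = 0 → D s (2 * π - y) = D s y := by
    intro s y h
    simp only [hD, hΦ, Function.uncurry, charMap_reflect, h, sub_zero]
    simpa using hφp s 0
  have hslice : ∀ {f : ℝ → ℝ → ℝ}, Continuous (Function.uncurry f) → ∀ s, Continuous (f s) :=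
    fun hf s => hf.comp (by fun_prop : Continuous fun y => (s, y))
  have hQ0 : ∀ s, 0 ≤ s → ∫ y in aliveSet s, Q' s y = 0 := by
    intro s hs
    obtain ⟨a, ha0, haπ, ha, hA⟩ := exists_aliveSet_eq_Ioo hs
    rw [hA, restrict_Ioo_eq_restrict_Ioc, ← intervalIntegral.integral_of_le (by linarith),
      intervalIntegral.integral_eq_sub_of_hasDerivAt (fun y _ => hQd s y)
        ((hslice hQc' s).intervalIntegrable _ _)]
    simp only [hQ, hD0 s a ha, Real.sin_two_pi_sub]
    ring
  have hAI : ∀ {f : ℝ → ℝ → ℝ}, Continuous (Function.uncurry f) → ∀ s, 0 ≤ s →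
      IntegrableOn (f s) (aliveSet s) := by
    intro f hf s hs
    refine ((hslice hf s).integrableOn_Icc (a := 0) (b := 2 * π)).mono_set fun y hy => ?_
    exact ⟨hy.1.1.le, hy.1.2.le⟩
  have hinner : ∀ s, 0 ≤ s → ∫ x in (0 : ℝ)..(2 * π),
      (sineSol s x * deriv (fun r => φ r x) s + sineSol s x ^ 2 / 2 * deriv (φ s) x) =
      ∫ y in aliveSet s, P' s y := by
    intro s hs
    simp_rw [hdt, hdx]
    rw [integral_sineSol_mul hs fun v x => v * φt (s, x) + v ^ 2 / 2 * φx (s, x),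
      ← add_zero (∫ y in aliveSet s, P' s y), ← hQ0 s hs,
      ← integral_add (hAI hPc' s hs) (hAI hQc' s hs)]
    refine integral_congr_ae (ae_of_all _ fun y => ?_)
    simp only [hP', hQ', hDt, hDx]
    ring
  have houter : ∫ s in (0 : ℝ)..t, ∫ x in (0 : ℝ)..(2 * π),
      (sineSol s x * deriv (fun r => φ r x) s + sineSol s x ^ 2 / 2 * deriv (φ s) x) =
      ∫ s in (0 : ℝ)..t, ∫ y in aliveSet s, P' s y := by
    refine intervalIntegral.integral_congr fun s hs => ?_
    rw [Set.uIcc_of_le ht] at hs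
    exact hinner s hs.1
  rw [houter, integral_deriv_aliveSet hPc hPc' hPd _ ht,
    integral_sineSol_mul ht fun v x => v * φ t x]
  · have e1 : ∫ x in (0 : ℝ)..(2 * π), P 0 x = ∫ x in (0 : ℝ)..(2 * π), -Real.sin x * φ 0 x := by
      refine intervalIntegral.integral_congr fun x _ => ?_
      simp [hP, hD, hΦ, charMap]
    have e2 : ∫ y in aliveSet t, (1 - t * Real.cos y) * (-Real.sin y * φ t (charMap t y)) =
        ∫ y in aliveSet t, P t y := by
      refine integral_congr_ae (ae_of_all _ fun y => ?_)
      simp only [hP, hD, hΦ, Function.uncurry]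
      ring
    rw [e1, e2]
    ring
  · intro s y h
    simp only [hP, hD0 s y h, Real.sin_two_pi_sub, Real.cos_two_pi_sub]
    ring

theorem integral_period_shift {h : ℝ → ℝ} (hh : Function.Periodic h (2 * π)) (ζ : ℝ) :
    ∫ x in (-π)..π, h x = ∫ x in (0 : ℝ)..(2 * π), h (x + ζ) := by
  rw [intervalIntegral.integral_comp_add_right]
  have := hh.intervalIntegral_add_eq (-π) (0 + ζ)
  rw [show -π + 2 * π = π by ring, show 0 + ζ + 2 * π = 2 * π + ζ by ring] at this
  exact this

theorem sineSol_shift_weak (ζ : ℝ) {φ : ℝ → ℝ → ℝ} (hφ : ContDiff ℝ ∞ (Function.uncurry φ))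
    (hφp : ∀ t, Function.Periodic (φ t) (2 * π)) {t : ℝ} (ht : 0 ≤ t) :
    ∫ x in (-π)..π, sineSol t (x - ζ) * φ t x =
      (∫ x in (-π)..π, initialData ζ x * φ 0 x) +
        ∫ s in (0 : ℝ)..t, ∫ x in (-π)..π,
          (sineSol s (x - ζ) * deriv (fun r => φ r x) s +
            sineSol s (x - ζ) ^ 2 / 2 * deriv (φ s) x) := by
  have hper : ∀ s x, sineSol s (x + 2 * π - ζ) = sineSol s (x - ζ) := fun s x => by
    rw [show x + 2 * π - ζ = x - ζ + 2 * π by ring, sineSol_periodic s (x - ζ)]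
  have hφ' : ContDiff ℝ ∞ (Function.uncurry fun s x => φ s (x + ζ)) := by
    have h : ContDiff ℝ ∞ fun p : ℝ × ℝ => (p.1, p.2 + ζ) := by fun_prop
    exact hφ.comp h
  have key := sineSol_weak hφ' (fun s x => by
    simp only [show x + 2 * π + ζ = x + ζ + 2 * π by ring, hφp s (x + ζ)]) ht
  simp only [deriv_comp_add_const] at key
  have e0 : ∫ x in (-π)..π, sineSol t (x - ζ) * φ t x =
      ∫ x in (0 : ℝ)..(2 * π), sineSol t x * φ t (x + ζ) := by
    rw [integral_period_shift (ζ := ζ) (h := fun x => sineSol t (x - ζ) * φ t x) (fun x => by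
      simp only [hper, hφp t x])]
    simp only [add_sub_cancel_right]
  have e1 : ∫ x in (-π)..π, initialData ζ x * φ 0 x =
      ∫ x in (0 : ℝ)..(2 * π), -Real.sin x * φ 0 (x + ζ) := by
    rw [integral_period_shift (ζ := ζ) (h := fun x => initialData ζ x * φ 0 x) (fun x => by
      simp only [initialData, show x + 2 * π - ζ = x - ζ + 2 * π by ring, Real.sin_add_two_pi,
        hφp 0 x])]
    simp only [initialData, add_sub_cancel_right]
  have e : ∀ s, ∫ x in (-π)..π, (sineSol s (x - ζ) * deriv (fun r => φ r x) s +
      sineSol s (x - ζ) ^ 2 / 2 * deriv (φ s) x) = ∫ x in (0 : ℝ)..(2 * π),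
      (sineSol s x * deriv (fun r => φ r (x + ζ)) s +
        sineSol s x ^ 2 / 2 * deriv (φ s) (x + ζ)) := by
    intro s
    rw [integral_period_shift (ζ := ζ)]
    · simp only [add_sub_cancel_right]
    · intro x
      have h1 : (fun r => φ r (x + 2 * π)) = fun r => φ r x := by
        ext r; exact hφp r x
      have h2 : deriv (φ s) (x + 2 * π) = deriv (φ s) x := by
        rw [← deriv_comp_add_const]
        congr 1
        ext y; exact hφp s y
      simp only [h1, h2, hper]
  simp only [e, e0, e1]
  exact key

theorem isBurgersEntropySolution_sineSol (ζ : ℝ) :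
    IsBurgersEntropySolution (initialData ζ) fun t x => sineSol t (x - ζ) := by
  refine ⟨?_, ?_, ?_, ?_, ?_⟩
  · have h : Measurable fun p : ℝ × ℝ => (p.1, p.2 - ζ) := by fun_prop
    have h2 := measurable_sineSol.comp h
    simp only [Function.comp_def, Function.uncurry_def] at h2 ⊢
    exact h2
  · intro t _ x
    have : x + 2 * π - ζ = x - ζ + 2 * π := by ring
    simp only [this, sineSol_periodic t (x - ζ)]
  · refine ⟨1, fun t _ => Filter.Eventually.of_forall fun x => ?_⟩
    simp only [sineSol, abs_neg]
    exact Real.abs_sin_le_one _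
  · intro φ hφ hφp t ht
    exact sineSol_shift_weak ζ hφ hφp ht
  · refine ⟨1, zero_le_one, fun t ht z hz => Filter.Eventually.of_forall fun x => ?_⟩
    have h := sineSol_oleinik (x := x - ζ) ht hz
    rw [show x + z - ζ = x - ζ + z by ring, one_mul, add_mul, one_mul, one_div_mul_eq_div]
    linarith

/-! ### Approximation of periodic functions by shallow networks -/

theorem abs_riemann_sum_sub_integral_le {F : ℝ → ℝ} {L : NNReal} (hF : LipschitzWith L F) {N : ℕ}
    (hN : 0 < N) :
    |(2 * π / N) * ∑ j ∈ Finset.range N, F (2 * π / N * j) - ∫ x in (0 : ℝ)..(2 * π), F x| ≤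
      L * (2 * π) ^ 2 / N := by
  have hN' : (0 : ℝ) < N := by exact_mod_cast hN
  have hπ : 0 < 2 * π := by linarith [Real.pi_pos]
  set h : ℝ := 2 * π / N with hh
  have hpos : 0 < h := div_pos hπ hN'
  have hFi : ∀ a b, IntervalIntegrable F MeasureTheory.volume a b := fun a b =>
    hF.continuous.intervalIntegrable a b
  have hsum := intervalIntegral.sum_integral_adjacent_intervals (f := F)
    (μ := MeasureTheory.volume) (a := fun j : ℕ => h * j) (n := N) fun k _ => hFi _ _
  have hend : h * N = 2 * π := by rw [hh]; field_simp
  simp only [Nat.cast_zero, mul_zero, hend] at hsum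
  rw [← hsum, Finset.mul_sum, ← Finset.sum_sub_distrib]
  have hterm : ∀ j ∈ Finset.range N,
      |h * F (h * j) - ∫ x in (h * j)..(h * (j + 1 : ℕ)), F x| ≤ L * h ^ 2 := by
    intro j _
    have hlen : h * ((j + 1 : ℕ) : ℝ) - h * j = h := by push_cast; ring
    have e1 : h * F (h * j) = ∫ _x in (h * j)..(h * (j + 1 : ℕ)), F (h * j) := by
      rw [intervalIntegral.integral_const, hlen, smul_eq_mul]
    rw [e1, ← intervalIntegral.integral_sub intervalIntegrable_const (hFi _ _)]
    have := intervalIntegral.norm_integral_le_of_norm_le_const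
      (f := fun x => F (h * j) - F x) (a := h * j) (b := h * (j + 1 : ℕ)) (C := L * h) ?_
    · rw [hlen, abs_of_pos hpos] at this
      rw [Real.norm_eq_abs] at this
      linarith
    · intro x hx
      rw [Set.uIoc_of_le (by linarith)] at hx
      have h1 := hF.dist_le_mul (h * j) x
      rw [Real.dist_eq, Real.dist_eq] at h1
      refine h1.trans (mul_le_mul_of_nonneg_left ?_ L.2)
      rw [abs_sub_comm, abs_of_nonneg (by linarith [hx.1])]
      linarith [hx.2]
  refine (Finset.abs_sum_le_sum_abs _ _).trans ((Finset.sum_le_sum hterm).trans (le_of_eq ?_))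
  rw [Finset.sum_const, Finset.card_range, nsmul_eq_mul, hh]
  field_simp

/-- A periodic bump supported near `2πℤ`; its translates are single ReLU neurons applied to
`(sin, cos)`. -/
noncomputable def cosBump (h x : ℝ) : ℝ := max 0 (Real.cos x - Real.cos h)

theorem cosBump_nonneg (h x : ℝ) : 0 ≤ cosBump h x := le_max_left _ _

theorem lipschitzWith_cosBump (h : ℝ) : LipschitzWith 1 (cosBump h) := by
  refine LipschitzWith.of_dist_le_mul fun x y => ?_
  rw [NNReal.coe_one, one_mul, Real.dist_eq, Real.dist_eq]
  refine (abs_max_sub_max_le_max _ _ _ _).trans ?_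
  rw [sub_self, abs_zero, max_eq_right (abs_nonneg _), sub_sub_sub_cancel_right]
  exact Real.abs_cos_sub_cos_le x y

theorem cosBump_periodic (h : ℝ) : Function.Periodic (cosBump h) (2 * π) := by
  intro x
  simp only [cosBump, Real.cos_add_two_pi]

theorem exists_int_of_cosBump_ne_zero {h x : ℝ} (h0 : 0 ≤ h)
    (hx : cosBump h x ≠ 0) : ∃ k : ℤ, |x - k * (2 * π)| < h := by
  have h2π : 0 < 2 * π := by linarith [Real.pi_pos]
  refine ⟨toIocDiv h2π (-π) x, ?_⟩
  have hmem := toIocMod_mem_Ioc h2π (-π) x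
  rw [self_sub_toIocDiv_mul]
  set r := toIocMod h2π (-π) x with hr
  have hcos : Real.cos r = Real.cos x := by
    rw [hr, ← self_sub_toIocDiv_mul, Real.cos_sub_int_mul_two_pi]
  by_contra hcon
  apply hx
  rw [cosBump, ← hcos, ← Real.cos_abs r]
  refine max_eq_left (sub_nonpos.2 ?_)
  refine Real.cos_le_cos_of_nonneg_of_le_pi h0 ?_ (not_lt.1 hcon)
  exact abs_le.2 ⟨hmem.1.le, by linarith [hmem.2]⟩

theorem integral_cosBump_pos {h : ℝ} (h0 : 0 < h) (hπ : h ≤ π) :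
    0 < ∫ x in (0 : ℝ)..(2 * π), cosBump h x := by
  have h2π : 0 < 2 * π := by linarith [Real.pi_pos]
  refine intervalIntegral.integral_pos h2π (lipschitzWith_cosBump h).continuous.continuousOn
    (fun x _ => cosBump_nonneg h x) ⟨0, ⟨le_rfl, h2π.le⟩, ?_⟩
  refine lt_max_of_lt_right (sub_pos.2 ?_)
  exact Real.cos_lt_cos_of_nonneg_of_le_pi le_rfl hπ h0

/-- A continuous periodic function is uniformly approximated by discretized convolution with a
bump. -/
theorem exists_cosBump_approx {E : Type*} [NormedAddCommGroup E] [NormedSpace ℝ E] {f : ℝ → E}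
    (hf : Continuous f) (hp : Function.Periodic f (2 * π)) {η : ℝ} (hη : 0 < η) :
    ∃ (N : ℕ) (h : ℝ) (θ : ℕ → ℝ) (c : ℕ → E),
      ∀ x, ‖f x - ∑ j ∈ Finset.range N, cosBump h (x - θ j) • c j‖ ≤ η := by
  have h2π : 0 < 2 * π := by linarith [Real.pi_pos]
  obtain ⟨B, hB⟩ := (hp.isBounded_of_continuous h2π.ne' hf).exists_norm_le
  have hB : ∀ x, ‖f x‖ ≤ B := fun x => hB _ ⟨x, rfl⟩
  have hB0 : 0 ≤ B := (norm_nonneg _).trans (hB 0)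
  have hint : ∀ (k : ℤ) x, f (x - k * (2 * π)) = f x := fun k x => hp.sub_int_mul_eq k
  -- a uniform modulus of continuity
  obtain ⟨h, hh0, hhπ, hh⟩ : ∃ h : ℝ, 0 < h ∧ h ≤ π ∧
      ∀ x y, |x - y| < h → ‖f x - f y‖ ≤ η / 4 := by
    have huc := isCompact_Icc (a := -π) (b := 3 * π) |>.uniformContinuousOn_of_continuous
      hf.continuousOn
    obtain ⟨δ, hδ0, hδ⟩ := Metric.uniformContinuousOn_iff.1 huc (η / 4) (by linarith)
    refine ⟨min δ π, lt_min hδ0 Real.pi_pos, min_le_right _ _, fun x y hxy => ?_⟩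
    have hmem := toIcoMod_mem_Ico h2π 0 x
    set k := toIcoDiv h2π 0 x with hk
    rw [← hint k x, ← hint k y, ← dist_eq_norm]
    have e : x - k * (2 * π) = toIcoMod h2π 0 x := self_sub_toIcoDiv_mul h2π 0 x
    have hd : |x - y| < π := hxy.trans_le (min_le_right _ _)
    have hd' := abs_lt.1 hd
    rw [← e] at hmem
    refine (hδ _ ⟨by linarith [hmem.1], by linarith [hmem.2]⟩ _
      ⟨by linarith [hmem.1], by linarith [hmem.2]⟩ ?_).le
    rw [Real.dist_eq, sub_sub_sub_cancel_right]
    exact hxy.trans_le (min_le_left _ _)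
  set κ := ∫ x in (0 : ℝ)..(2 * π), cosBump h x with hκ
  have hκ0 : 0 < κ := integral_cosBump_pos hh0 hhπ
  obtain ⟨N, hN⟩ := exists_nat_gt ((2 * π) ^ 2 / (κ * min 1 (η / (4 * (B + 1)))))
  have hm0 : 0 < min 1 (η / (4 * (B + 1))) := lt_min one_pos (by positivity)
  have hN0 : 0 < (N : ℝ) := lt_of_le_of_lt (by positivity) hN
  have hN1 : (2 * π) ^ 2 / N / κ ≤ min 1 (η / (4 * (B + 1))) := by
    rw [div_lt_iff₀ (by positivity)] at hN
    rw [div_div, div_le_iff₀ (by positivity)]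
    linarith
  set q : ℝ := 2 * π / N with hq
  have hq0 : 0 < q := div_pos h2π hN0
  refine ⟨N, h, fun j => q * j, fun j => (q / κ) • f (q * j), fun x => ?_⟩
  set S : ℝ := q * ∑ j ∈ Finset.range N, cosBump h (x - q * j) with hS
  have hSκ : |S - κ| ≤ (2 * π) ^ 2 / N := by
    have hL : LipschitzWith 1 fun y => cosBump h (x - y) := by
      refine LipschitzWith.of_dist_le_mul fun y z => ?_
      have := (lipschitzWith_cosBump h).dist_le_mul (x - y) (x - z)
      rwa [dist_sub_left] at this
    have h1 := abs_riemann_sum_sub_integral_le hL (N := N) (by exact_mod_cast hN0)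
    have h2 : ∫ y in (0 : ℝ)..(2 * π), cosBump h (x - y) = κ := by
      rw [intervalIntegral.integral_comp_sub_left]
      have := (cosBump_periodic h).intervalIntegral_add_eq (x - 2 * π) 0
      rwa [sub_add_cancel, zero_add, ← sub_zero x, sub_sub, zero_add] at this
    rw [h2, NNReal.coe_one, one_mul] at h1
    exact h1
  have hS0 : 0 ≤ S := mul_nonneg hq0.le (Finset.sum_nonneg fun j _ => cosBump_nonneg _ _)
  have hdiff : |1 - S / κ| ≤ min 1 (η / (4 * (B + 1))) := by
    have : 1 - S / κ = (κ - S) / κ := by field_simp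
    rw [this, abs_div, abs_of_pos hκ0, abs_sub_comm]
    refine le_trans ?_ hN1
    gcongr
  have hSle : S / κ ≤ 2 := by
    have := (abs_le.1 (hdiff.trans (min_le_left _ _))).1
    linarith
  have hsplit : f x - ∑ j ∈ Finset.range N, cosBump h (x - q * j) • (q / κ) • f (q * j) =
      (1 - S / κ) • f x +
        ∑ j ∈ Finset.range N, (cosBump h (x - q * j) * (q / κ)) • (f x - f (q * j)) := by
    simp only [smul_sub, Finset.sum_sub_distrib, smul_smul]
    rw [← Finset.sum_smul, sub_smul, one_smul, ← Finset.sum_mul]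
    have : (∑ j ∈ Finset.range N, cosBump h (x - q * j)) * (q / κ) = S / κ := by
      rw [hS]; ring
    rw [this]
    abel
  have hterm : ∀ j ∈ Finset.range N,
      ‖(cosBump h (x - q * j) * (q / κ)) • (f x - f (q * j))‖ ≤
        cosBump h (x - q * j) * (q / κ) * (η / 4) := by
    intro j _
    have hc := cosBump_nonneg h (x - q * j)
    rw [norm_smul, Real.norm_of_nonneg (by positivity)]
    by_cases hz : cosBump h (x - q * j) = 0
    · simp [hz]
    · obtain ⟨k, hk⟩ := exists_int_of_cosBump_ne_zero hh0.le hz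
      refine mul_le_mul_of_nonneg_left ?_ (by positivity)
      rw [← hint k x]
      exact hh _ _ (by rwa [sub_right_comm] at hk)
  rw [hsplit]
  refine (norm_add_le _ _).trans ?_
  have p1 : ‖(1 - S / κ) • f x‖ ≤ η / 4 := by
    rw [norm_smul, Real.norm_eq_abs]
    calc |1 - S / κ| * ‖f x‖ ≤ (η / (4 * (B + 1))) * B :=
          mul_le_mul (hdiff.trans (min_le_right _ _)) (hB x) (norm_nonneg _) (by positivity)
      _ ≤ (η / (4 * (B + 1))) * (B + 1) := by gcongr; linarith
      _ = η / 4 := by field_simp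
  have p2 : ‖∑ j ∈ Finset.range N, (cosBump h (x - q * j) * (q / κ)) • (f x - f (q * j))‖ ≤
      η / 2 := by
    refine (norm_sum_le _ _).trans ((Finset.sum_le_sum hterm).trans ?_)
    rw [← Finset.sum_mul, ← Finset.sum_mul]
    have : (∑ j ∈ Finset.range N, cosBump h (x - q * j)) * (q / κ) = S / κ := by
      rw [hS]; ring
    rw [this]
    nlinarith
  linarith

theorem exists_reLUNet_approx {n : ℕ} {f : ℝ → Fin n → ℝ} (hf : Continuous f)
    (hp : Function.Periodic f (2 * π)) {η : ℝ} (hη : 0 < η) :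
    ∃ B : ReLUNet 2 n, ∀ x k, |B.eval ![Real.sin x, Real.cos x] k - f x k| ≤ η := by
  obtain ⟨N, h, θ, c, hc⟩ := exists_cosBump_approx hf hp hη
  refine ⟨.hidden (Matrix.of fun (j : Fin N) => ![Real.sin (θ j), Real.cos (θ j)])
    (fun _ => -Real.cos h) (.output (Matrix.of fun k (j : Fin N) => c j k) 0), fun x k => ?_⟩
  have h1 := norm_le_pi_norm (f x - ∑ j ∈ Finset.range N, cosBump h (x - θ j) • c j) k
  have h2 := h1.trans (hc x)
  rw [abs_sub_comm]
  refine le_trans (le_of_eq ?_) h2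
  rw [Real.norm_eq_abs]
  congr 1
  simp only [ReLUNet.eval, Matrix.mulVec, dotProduct, Fin.sum_univ_two, Matrix.of_apply,
    Matrix.cons_val_zero, Matrix.cons_val_one, Pi.sub_apply, Finset.sum_apply, Pi.smul_apply,
    smul_eq_mul, Pi.zero_apply, add_zero, Finset.sum_range]
  congr 1
  refine Finset.sum_congr rfl fun j _ => ?_
  rw [cosBump, Real.cos_sub, max_comm, mul_comm]
  congr 2
  ring

/-! ### Explicit networks -/

/-- Composition of a network with an affine map on the output side. -/
def ReLUNet.affineOutput {n' : ℕ} : {m n : ℕ} → ReLUNet m n → Matrix (Fin n') (Fin n) ℝ →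
    (Fin n' → ℝ) → ReLUNet m n'
  | _, _, .output A b, M, e => .output (M * A) (fun i => M.mulVec b i + e i)
  | _, _, .hidden A b N, M, e => .hidden A b (N.affineOutput M e)

theorem ReLUNet.eval_affineOutput {n' : ℕ} : ∀ {m n : ℕ} (N : ReLUNet m n)
    (M : Matrix (Fin n') (Fin n) ℝ) (e : Fin n' → ℝ) (x : Fin m → ℝ) (i : Fin n'),
    (N.affineOutput M e).eval x i = M.mulVec (N.eval x) i + e i
  | _, _, .output A b, M, e, x, i => by
    have : (fun i => A.mulVec x i + b i) = A.mulVec x + b := rfl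
    simp only [ReLUNet.affineOutput, ReLUNet.eval, this, Matrix.mulVec_add, Matrix.mulVec_mulVec,
      Pi.add_apply]
    ring
  | _, _, .hidden A b N, M, e, x, i => by
    simp only [ReLUNet.affineOutput, ReLUNet.eval]
    exact N.eval_affineOutput M e _ i

/-- The hat function of width one. -/
def hat (t : ℝ) : ℝ := max (t + 1) 0 - 2 * max t 0 + max (t - 1) 0

theorem hat_eq_zero {t : ℝ} (h : 1 ≤ |t|) : hat t = 0 := by
  rw [hat]
  rcases le_abs.1 h with h | h
  · rw [max_eq_left (by linarith), max_eq_left (by linarith), max_eq_left (by linarith)]; ring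
  · rw [max_eq_right (by linarith), max_eq_right (by linarith), max_eq_right (by linarith)]; ring

theorem hat_of_nonneg {t : ℝ} (h0 : 0 ≤ t) (h1 : t ≤ 1) : hat t = 1 - t := by
  rw [hat, max_eq_left (by linarith), max_eq_left h0, max_eq_right (by linarith)]; ring

theorem hat_of_nonpos {t : ℝ} (h0 : t ≤ 0) (h1 : -1 ≤ t) : hat t = 1 + t := by
  rw [hat, max_eq_left (by linarith), max_eq_right h0, max_eq_right (by linarith)]; ring

/-- Hat functions at the integers give piecewise linear interpolation. -/
theorem sum_mul_hat {n j : ℕ} (hj : j + 1 < n) (c : Fin n → ℝ) {l : ℝ} (h0 : 0 ≤ l) (h1 : l ≤ 1) :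
    ∑ k : Fin n, c k * hat ((j + l) - (k : ℕ)) =
      (1 - l) * c ⟨j, by omega⟩ + l * c ⟨j + 1, hj⟩ := by
  have hne : (⟨j, by omega⟩ : Fin n) ≠ ⟨j + 1, hj⟩ := by
    intro h
    have := congrArg Fin.val h
    simp at this
  rw [← Finset.sum_subset (Finset.subset_univ {(⟨j, by omega⟩ : Fin n), ⟨j + 1, hj⟩}),
    Finset.sum_pair hne]
  · have e1 : ((j : ℝ) + l - ((j : ℕ) : ℝ)) = l := by ring
    have e2 : ((j : ℝ) + l - ((j + 1 : ℕ) : ℝ)) = l - 1 := by push_cast; ring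
    simp only [e1, e2]
    rw [hat_of_nonneg h0 h1, hat_of_nonpos (by linarith) (by linarith)]
    ring
  · intro k _ hk
    simp only [Finset.mem_insert, Finset.mem_singleton, not_or] at hk
    rw [hat_eq_zero, mul_zero]
    have hk1 : (k : ℕ) ≠ j := fun h => hk.1 (Fin.ext h)
    have hk2 : (k : ℕ) ≠ j + 1 := fun h => hk.2 (Fin.ext h)
    rcases lt_or_ge (k : ℕ) j with h | h
    · have : ((k : ℕ) : ℝ) + 1 ≤ j := by exact_mod_cast h
      exact le_abs.2 (Or.inl (by linarith))
    · have h3 : j + 2 ≤ (k : ℕ) := by omega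
      have : (j : ℝ) + 2 ≤ ((k : ℕ) : ℝ) := by exact_mod_cast h3
      exact le_abs.2 (Or.inr (by linarith))

theorem matrix_mulVec_second_difference {n : ℕ} (v : ℕ → ℝ) (k : Fin n) :
    (Matrix.of fun (k : Fin n) (j : Fin (n + 2)) => if (j : ℕ) = k then (1 : ℝ) else
      if (j : ℕ) = k + 1 then -2 else if (j : ℕ) = k + 2 then 1 else 0).mulVec
        (fun j => v j) k = v k - 2 * v (k + 1) + v (k + 2) := by
  have hk := k.2
  simp only [Matrix.mulVec, dotProduct, Matrix.of_apply]
  have : ∀ j : Fin (n + 2), (if (j : ℕ) = k then (1 : ℝ) else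
      if (j : ℕ) = k + 1 then -2 else if (j : ℕ) = k + 2 then 1 else 0) * v j =
      (if j = ⟨k, by omega⟩ then v k else 0) + (if j = ⟨k + 1, by omega⟩ then -2 * v (k + 1) else 0) +
      (if j = ⟨k + 2, by omega⟩ then v (k + 2) else 0) := by
    intro j
    simp only [Fin.ext_iff]
    rcases eq_or_ne (j : ℕ) k with h | h
    · simp [h]
    rcases eq_or_ne (j : ℕ) (k + 1) with h' | h'
    · simp [h']
    rcases eq_or_ne (j : ℕ) (k + 2) with h'' | h''
    · simp [h'']
    · simp [h, h', h'']
  simp only [this, Finset.sum_add_distrib, Finset.sum_ite_eq', Finset.mem_univ, if_true]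
  ring

/-- Trunk net of hat functions in the coordinate
`t = a x + b + d (max (x + δ) 0 - max (x - δ) 0)`. -/
theorem exists_hat_trunk (n : ℕ) (a b d δ : ℝ) : ∃ N : ReLUNet 1 n, ∀ x k,
    N.eval (fun _ => x) k =
      hat ((a * x + b + d * (max (x + δ) 0 - max (x - δ) 0)) - (k : ℕ)) := by
  refine ⟨.hidden (Matrix.of ![![1], ![-1], ![1], ![1]]) ![0, 0, δ, -δ]
    (.hidden (Matrix.of fun (_ : Fin (n + 2)) => ![a, -a, d, -d])
      (fun j => b + 1 - (j : ℕ))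
      (.output (Matrix.of fun (k : Fin n) (j : Fin (n + 2)) => if (j : ℕ) = k then (1 : ℝ) else
        if (j : ℕ) = k + 1 then -2 else if (j : ℕ) = k + 2 then 1 else 0) 0)), fun x k => ?_⟩
  set t : ℝ := a * x + b + d * (max (x + δ) 0 - max (x - δ) 0) with ht
  have hx : max x 0 - max (-x) 0 = x := by
    rcases le_total 0 x with h | h
    · rw [max_eq_left h, max_eq_right (by linarith)]; ring
    · rw [max_eq_right h, max_eq_left (by linarith)]; ring
  simp only [ReLUNet.eval]
  rw [Pi.zero_apply, add_zero]
  have key : ∀ j : Fin (n + 2), max ((Matrix.of fun (_ : Fin (n + 2)) => ![a, -a, d, -d]).mulVec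
      (fun i => max ((Matrix.of ![![(1 : ℝ)], ![-1], ![1], ![1]]).mulVec (fun _ => x) i +
        ![0, 0, δ, -δ] i) 0) j + (b + 1 - ((j : ℕ) : ℝ))) 0 = max (t + 1 - ((j : ℕ) : ℝ)) 0 := by
    intro j
    congr 1
    simp [Matrix.mulVec, dotProduct, Fin.sum_univ_four]
    rw [ht]
    rw [← sub_eq_add_neg]
    linear_combination a * hx
  simp only [key]
  rw [matrix_mulVec_second_difference (fun j : ℕ => max (t + 1 - (j : ℝ)) 0) k, hat]
  push_cast
  ring_nf

/-! ### The profile after the formation of the shock -/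

theorem sin_interpolation_error (a b : ℝ) {l : ℝ} (hl0 : 0 ≤ l) (hl1 : l ≤ 1) :
    |Real.sin ((1 - l) * a + l * b) - ((1 - l) * Real.sin a + l * Real.sin b)| ≤ (b - a) ^ 2 := by
  -- `y² / 2 ± sin y` is convex
  have hconv : ∀ σ : ℝ, |σ| ≤ 1 → ConvexOn ℝ Set.univ fun y : ℝ => y ^ 2 / 2 + σ * Real.sin y := by
    intro σ hσ
    have d1 : ∀ y : ℝ, HasDerivAt (fun y : ℝ => y ^ 2 / 2 + σ * Real.sin y)
        (y + σ * Real.cos y) y := by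
      intro y
      refine (((hasDerivAt_id y).pow 2).div_const 2 |>.add
        ((Real.hasDerivAt_sin y).const_mul σ)).congr_deriv ?_
      simp
    have d2 : ∀ y : ℝ, HasDerivAt (fun y : ℝ => y + σ * Real.cos y) (1 - σ * Real.sin y) y := by
      intro y
      refine ((hasDerivAt_id y).add ((Real.hasDerivAt_cos y).const_mul σ)).congr_deriv ?_
      ring
    have e1 : deriv (fun y : ℝ => y ^ 2 / 2 + σ * Real.sin y) = fun y => y + σ * Real.cos y :=
      funext fun y => (d1 y).deriv
    refine convexOn_univ_of_deriv2_nonneg (fun y => (d1 y).differentiableAt) ?_ fun y => ?_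
    · rw [e1]; exact fun y => (d2 y).differentiableAt
    · simp only [Function.iterate_succ, Function.iterate_zero, Function.comp, id, e1, (d2 y).deriv]
      have h1 : |σ * Real.sin y| ≤ 1 := by
        rw [abs_mul]
        exact mul_le_one₀ hσ (abs_nonneg _) (Real.abs_sin_le_one y)
      linarith [(abs_le.1 h1).2]
  have h1 := (hconv 1 (by simp)).2 (Set.mem_univ a) (Set.mem_univ b) (by linarith : 0 ≤ 1 - l) hl0
    (by ring)
  have h2 := (hconv (-1) (by simp)).2 (Set.mem_univ a) (Set.mem_univ b) (by linarith : 0 ≤ 1 - l)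
    hl0 (by ring)
  simp only [smul_eq_mul] at h1 h2
  have h3 : 0 ≤ (b - a) ^ 2 := sq_nonneg _
  have h4 : l * (1 - l) / 2 * (b - a) ^ 2 ≤ 1 * (b - a) ^ 2 :=
    mul_le_mul_of_nonneg_right (by nlinarith) h3
  rw [abs_le]
  constructor <;> nlinarith

/-- The inverse, on `[0, 2π]`, of the characteristic map at a time after shock formation; there
the feet range in `[π/2, 3π/2]`, where the characteristic map is expanding. -/
noncomputable def profileFoot (T x : ℝ) : ℝ :=
  Function.invFunOn (charMap T) (Set.Icc (π / 2) (3 * π / 2)) x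

theorem profileFoot_spec {T : ℝ} (hT : π < T) {x : ℝ} (hx : x ∈ Set.Icc 0 (2 * π)) :
    profileFoot T x ∈ Set.Icc (π / 2) (3 * π / 2) ∧ charMap T (profileFoot T x) = x := by
  have hπ := Real.pi_pos
  have h1 := intermediate_value_Icc (f := charMap T) (a := π / 2) (b := 3 * π / 2) (by linarith)
    (continuous_charMap T).continuousOn
  have h2 : Real.sin (3 * π / 2) = -1 := by
    rw [show 3 * π / 2 = π / 2 + π by ring, Real.sin_add_pi, Real.sin_pi_div_two]
  have h3 : x ∈ charMap T '' Set.Icc (π / 2) (3 * π / 2) := by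
    refine h1 ⟨?_, ?_⟩
    · simp only [charMap, Real.sin_pi_div_two]; linarith [hx.1]
    · simp only [charMap, h2]; linarith [hx.2]
  exact ⟨Function.invFunOn_mem h3, Function.invFunOn_eq h3⟩

theorem sin_antitone_middle {y y' : ℝ} (hy : y ∈ Set.Icc (π / 2) (3 * π / 2))
    (hy' : y' ∈ Set.Icc (π / 2) (3 * π / 2)) (h : y ≤ y') : Real.sin y' ≤ Real.sin y := by
  have e : ∀ z, Real.sin z = -Real.sin (z - π) := fun z => by rw [Real.sin_sub_pi]; ring
  rw [e y, e y', neg_le_neg_iff]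
  exact Real.sin_le_sin_of_le_of_le_pi_div_two (by linarith [hy.1]) (by linarith [hy'.2])
    (by linarith)

theorem abs_sub_le_abs_charMap_sub {T : ℝ} (hT : 0 ≤ T) {y y' : ℝ}
    (hy : y ∈ Set.Icc (π / 2) (3 * π / 2)) (hy' : y' ∈ Set.Icc (π / 2) (3 * π / 2)) :
    |y - y'| ≤ |charMap T y - charMap T y'| := by
  wlog h : y ≤ y' generalizing y y'
  · rw [abs_sub_comm, abs_sub_comm (charMap T y)]
    exact this hy' hy (le_of_not_ge h)
  have hs := sin_antitone_middle hy hy' h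
  have : charMap T y - charMap T y' ≤ y - y' := by simp only [charMap]; nlinarith
  rw [abs_of_nonpos (by linarith), abs_of_nonpos (by linarith)]
  linarith

/-- The profile of the solution at time `T` on one period, extended continuously to the closed
period and by constants beyond it. -/
noncomputable def profile (T x : ℝ) : ℝ :=
  -Real.sin (profileFoot T (max 0 (min x (2 * π))))

theorem clamp_mem (x : ℝ) : max 0 (min x (2 * π)) ∈ Set.Icc 0 (2 * π) :=
  ⟨le_max_left _ _, max_le (by linarith [Real.pi_pos]) (min_le_right _ _)⟩

theorem clamp_of_mem {x : ℝ} (hx : x ∈ Set.Icc 0 (2 * π)) : max 0 (min x (2 * π)) = x := by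
  rw [min_eq_left hx.2, max_eq_right hx.1]

theorem abs_profile_le_one (T x : ℝ) : |profile T x| ≤ 1 := by
  rw [profile, abs_neg]; exact Real.abs_sin_le_one _

theorem sineSol_eq_profile {T : ℝ} (hT : π < T) {x : ℝ} (hx : x ∈ Set.Ioo 0 (2 * π)) :
    sineSol T x = profile T x := by
  have hπ := Real.pi_pos
  have hx' := Set.Ioo_subset_Icc_self hx
  obtain ⟨h1, h2⟩ := profileFoot_spec hT hx'
  have h3 : profileFoot T x ∈ aliveSet T :=
    ⟨⟨by linarith [h1.1], by linarith [h1.2]⟩, by rw [h2]; exact hx⟩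
  rw [sineSol_of_mem hx, profile, clamp_of_mem hx']
  congr 2
  rw [← charFoot_charMap (by linarith) h3, h2]

theorem abs_profile_sub_le {T : ℝ} (hT : π < T) (x x' : ℝ) :
    |profile T x - profile T x'| ≤ |x - x'| := by
  obtain ⟨h1, h2⟩ := profileFoot_spec hT (clamp_mem x)
  obtain ⟨h3, h4⟩ := profileFoot_spec hT (clamp_mem x')
  have h5 := abs_sub_le_abs_charMap_sub (T := T) (by linarith [Real.pi_pos]) h1 h3
  rw [h2, h4] at h5
  have h6 : |max 0 (min x (2 * π)) - max 0 (min x' (2 * π))| ≤ |x - x'| := by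
    refine (abs_max_sub_max_le_max _ _ _ _).trans ?_
    rw [sub_self, abs_zero, max_eq_right (abs_nonneg _)]
    refine (abs_min_sub_min_le_max _ _ _ _).trans ?_
    rw [sub_self, abs_zero, max_eq_left (abs_nonneg _)]
  have h7 : |profile T x - profile T x'| ≤
      |profileFoot T (max 0 (min x (2 * π))) - profileFoot T (max 0 (min x' (2 * π)))| := by
    have := Real.lipschitzWith_sin.dist_le_mul (profileFoot T (max 0 (min x (2 * π))))
      (profileFoot T (max 0 (min x' (2 * π))))
    rw [NNReal.coe_one, one_mul, Real.dist_eq, Real.dist_eq] at this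
    simp only [profile]
    rwa [neg_sub_neg, abs_sub_comm]
  linarith

theorem continuous_profile {T : ℝ} (hT : π < T) : Continuous (profile T) := by
  refine (LipschitzWith.of_dist_le_mul (K := 1) fun x y => ?_).continuous
  rw [NNReal.coe_one, one_mul, Real.dist_eq, Real.dist_eq]
  exact abs_profile_sub_le hT x y

/-- Linear interpolation of the profile is second order accurate. The foot is the inverse of an
expanding map, so its interpolation error is at most that of the characteristic map itself. -/
theorem profile_interpolation_error {T : ℝ} (hT : π < T) {x₀ x₁ l : ℝ}
    (h0 : x₀ ∈ Set.Icc 0 (2 * π)) (h1 : x₁ ∈ Set.Icc 0 (2 * π)) (hl0 : 0 ≤ l) (hl1 : l ≤ 1) :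
    |profile T ((1 - l) * x₀ + l * x₁) - ((1 - l) * profile T x₀ + l * profile T x₁)| ≤
      (x₁ - x₀) ^ 2 := by
  have hT0 : 0 < T := Real.pi_pos.trans hT
  have hx : (1 - l) * x₀ + l * x₁ ∈ Set.Icc 0 (2 * π) :=
    convex_Icc _ _ h0 h1 (by linarith) hl0 (by ring)
  set x := (1 - l) * x₀ + l * x₁ with hxdef
  obtain ⟨a1, b1⟩ := profileFoot_spec hT h0
  obtain ⟨a2, b2⟩ := profileFoot_spec hT h1
  obtain ⟨a3, b3⟩ := profileFoot_spec hT hx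
  rw [profile, profile, profile, clamp_of_mem h0, clamp_of_mem h1, clamp_of_mem hx]
  set y₀ := profileFoot T x₀
  set y₁ := profileFoot T x₁
  set y := profileFoot T x
  have hy : (1 - l) * y₀ + l * y₁ ∈ Set.Icc (π / 2) (3 * π / 2) :=
    convex_Icc _ _ a1 a2 (by linarith) hl0 (by ring)
  have e1 := abs_sub_le_abs_charMap_sub hT0.le a3 hy
  have e2 := sin_interpolation_error y₀ y₁ hl0 hl1
  have e3 := abs_sub_le_abs_charMap_sub hT0.le a2 a1
  rw [b2, b1] at e3
  have e4 : (y₁ - y₀) ^ 2 ≤ (x₁ - x₀) ^ 2 := sq_le_sq.2 e3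
  have hmul : ∀ z, T * |z| = |T * z| := fun z => by rw [abs_mul, abs_of_pos hT0]
  have hkey : T * |(-Real.sin y - ((1 - l) * -Real.sin y₀ + l * -Real.sin y₁))| =
      |y - ((1 - l) * y₀ + l * y₁)| := by
    rw [hmul, ← abs_neg]
    congr 1
    simp only [charMap] at b1 b2 b3
    rw [hxdef] at b3
    linear_combination (1 - l) * b1 + l * b2 - b3
  have hkey2 : |charMap T y - charMap T ((1 - l) * y₀ + l * y₁)| =
      T * |Real.sin ((1 - l) * y₀ + l * y₁) - ((1 - l) * Real.sin y₀ + l * Real.sin y₁)| := by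
    rw [hmul, b3]
    congr 1
    simp only [charMap] at b1 b2 ⊢
    rw [hxdef]
    linear_combination - (1 - l) * b1 - l * b2
  rw [← hkey, hkey2] at e1
  exact ((mul_le_mul_iff_right₀ hT0).1 e1).trans (e2.trans e4)

/-! ### The coordinate net and the solution net -/

/-- The piecewise linear map of `[-π, π]` fixing the endpoints and moving `0` to `s`. -/
noncomputable def shiftMap (s ξ : ℝ) : ℝ := ξ + s * (1 - |ξ| / π)

theorem strictMono_shiftMap {s : ℝ} (hs : |s| < π) : StrictMono (shiftMap s) := by
  intro x y hxy
  have hπ := Real.pi_pos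
  have h1 : |(|y| - |x|)| ≤ y - x := (abs_abs_sub_abs_le _ _).trans (abs_of_pos (by linarith)).le
  have h2 : |s * (|y| - |x|)| < π * (y - x) := by
    rw [abs_mul]
    calc |s| * |(|y| - |x|)| ≤ |s| * (y - x) := mul_le_mul_of_nonneg_left h1 (abs_nonneg _)
      _ < π * (y - x) := mul_lt_mul_of_pos_right hs (by linarith)
  have h3 := (abs_lt.1 h2).2
  have h4 : shiftMap s y - shiftMap s x = ((y - x) * π - s * (|y| - |x|)) / π := by
    simp only [shiftMap]; field_simp; ring
  have h5 : 0 < shiftMap s y - shiftMap s x := by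
    rw [h4]; exact div_pos (by linarith) hπ
  linarith

theorem bijOn_shiftMap {s : ℝ} (hs : |s| < π) :
    Set.BijOn (shiftMap s) (Set.Icc (-π) π) (Set.Icc (-π) π) := by
  have hπ := Real.pi_pos
  have hmono := strictMono_shiftMap hs
  have e1 : shiftMap s (-π) = -π := by
    simp only [shiftMap, abs_neg, abs_of_pos hπ, div_self hπ.ne', sub_self, mul_zero, add_zero]
  have e2 : shiftMap s π = π := by
    simp only [shiftMap, abs_of_pos hπ, div_self hπ.ne', sub_self, mul_zero, add_zero]
  refine ⟨fun x hx => ⟨?_, ?_⟩, hmono.injective.injOn, ?_⟩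
  · rw [← e1]; exact hmono.monotone hx.1
  · rw [← e2]; exact hmono.monotone hx.2
  · have hc : Continuous (shiftMap s) := by unfold shiftMap; fun_prop
    have := intermediate_value_Icc (f := shiftMap s) (a := -π) (b := π) (by linarith)
      hc.continuousOn
    rwa [e1, e2] at this

theorem shiftMap_of_nonneg (s : ℝ) {ξ : ℝ} (h : 0 ≤ ξ) : shiftMap s ξ - s = ξ * (1 - s / π) := by
  rw [shiftMap, abs_of_nonneg h]; ring

theorem shiftMap_of_nonpos (s : ℝ) {ξ : ℝ} (h : ξ ≤ 0) : shiftMap s ξ - s = ξ * (1 + s / π) := by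
  rw [shiftMap, abs_of_nonpos h]; ring

/-- Sampling at two points determines the phase: the sampled values are `sin ζ` and `cos ζ`. -/
theorem sample_initialData (ζ : ℝ) :
    (fun j => initialData ζ ((![0, -(π / 2)] : Fin 2 → ℝ) j)) = ![Real.sin ζ, Real.cos ζ] := by
  ext j
  fin_cases j
  · simp [initialData]
  · have : -(π / 2) - ζ = -(ζ + π / 2) := by ring
    change -Real.sin (-(π / 2) - ζ) = Real.cos ζ
    rw [this, Real.sin_neg, neg_neg, Real.sin_add_pi_div_two]

theorem exists_deepONet_eq_shiftMap (n : ℕ) (B : ReLUNet 2 1) :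
    ∃ X : DeepONet (n + 2), ∀ ζ,
      X.eval (initialData ζ) = shiftMap (B.eval ![Real.sin ζ, Real.cos ζ] 0) := by
  refine ⟨⟨2, ![0, -(π / 2)],
    B.affineOutput (Matrix.of fun k _ => if (k : ℕ) = 1 then 1 else 0)
      (fun k => if (k : ℕ) = 0 then 1 else 0),
    .hidden (Matrix.of ![![1], ![-1]]) 0 (.output
      (Matrix.of fun k => if (k : ℕ) = 0 then ![1, -1] else
        if (k : ℕ) = 1 then ![-1 / π, -1 / π] else ![0, 0])
      (fun k => if (k : ℕ) = 1 then 1 else 0))⟩, fun ζ => ?_⟩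
  ext ξ
  have h1 : max ξ 0 - max (-ξ) 0 = ξ := by
    rcases le_total 0 ξ with h | h
    · rw [max_eq_left h, max_eq_right (by linarith)]; ring
    · rw [max_eq_right h, max_eq_left (by linarith)]; ring
  have h2 : max ξ 0 + max (-ξ) 0 = |ξ| := by
    rcases le_total 0 ξ with h | h
    · rw [max_eq_left h, max_eq_right (by linarith), abs_of_nonneg h]; ring
    · rw [max_eq_right h, max_eq_left (by linarith), abs_of_nonpos h]; ring
  simp only [DeepONet.eval, sample_initialData, ReLUNet.eval_affineOutput]
  rw [Fin.sum_univ_succ, Fin.sum_univ_succ, Finset.sum_eq_zero]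
  · simp [ReLUNet.eval, Matrix.mulVec, dotProduct]
    rw [shiftMap, ← h2]
    linear_combination h1
  · intro k _
    simp [ReLUNet.eval, Matrix.mulVec, dotProduct]

theorem ReLUNet.continuous_eval : ∀ {m n : ℕ} (N : ReLUNet m n), Continuous N.eval
  | _, _, .output A b => by
    simp only [ReLUNet.eval, Matrix.mulVec, dotProduct]
    fun_prop
  | _, _, .hidden A b N => by
    have h := N.continuous_eval
    have h2 : Continuous fun x : Fin _ → ℝ => fun i => max (A.mulVec x i + b i) 0 := by
      simp only [Matrix.mulVec, dotProduct]
      fun_prop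
    exact h.comp h2

/-- The coordinate in which the trunk hat functions sit at integers: linear on `[-π, -δ]` and on
`[δ, π]`, with slope `N / π`, and jumping by `1` across the shock zone `[-δ, δ]`. -/
noncomputable def nodeCoord (N : ℕ) (δ ξ : ℝ) : ℝ :=
  N / π * ξ + N + 1 / (2 * δ) * (max (ξ + δ) 0 - max (ξ - δ) 0)

theorem nodeCoord_of_le {N : ℕ} {δ ξ : ℝ} (hδ : 0 < δ) (h : ξ ≤ -δ) :
    nodeCoord N δ ξ = N / π * ξ + N := by
  rw [nodeCoord, max_eq_right (by linarith), max_eq_right (by linarith)]; ring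

theorem nodeCoord_of_ge {N : ℕ} {δ ξ : ℝ} (hδ : 0 < δ) (h : δ ≤ ξ) :
    nodeCoord N δ ξ = N / π * ξ + N + 1 := by
  rw [nodeCoord, max_eq_left (by linarith), max_eq_left (by linarith)]
  field_simp
  ring

theorem nodeCoord_mem {N : ℕ} {δ ξ : ℝ} (hδ : 0 < δ) (hξ : ξ ∈ Set.Icc (-π) π) :
    nodeCoord N δ ξ ∈ Set.Icc (0 : ℝ) (2 * N + 1) := by
  have hπ := Real.pi_pos
  have h1 : 0 ≤ max (ξ + δ) 0 - max (ξ - δ) 0 := by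
    rw [sub_nonneg]
    exact max_le_max_right 0 (by linarith)
  have h2 : max (ξ + δ) 0 - max (ξ - δ) 0 ≤ 2 * δ := by
    rw [sub_le_iff_le_add]
    refine max_le ?_ ?_
    · linarith [le_max_left (ξ - δ) 0]
    · linarith [le_max_right (ξ - δ) 0]
  have h3 : 0 ≤ 1 / (2 * δ) * (max (ξ + δ) 0 - max (ξ - δ) 0) := by positivity
  have h4 : 1 / (2 * δ) * (max (ξ + δ) 0 - max (ξ - δ) 0) ≤ 1 := by
    rw [one_div_mul_eq_div, div_le_one (by positivity)]; exact h2
  have h5 : N / π * (-π) ≤ N / π * ξ := mul_le_mul_of_nonneg_left hξ.1 (by positivity)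
  have h6 : N / π * ξ ≤ N / π * π := mul_le_mul_of_nonneg_left hξ.2 (by positivity)
  have h7 : (N : ℝ) / π * π = N := by field_simp
  rw [nodeCoord]
  constructor <;> nlinarith

theorem exists_nat_cell {p N : ℕ} (hN : 0 < N) {t : ℝ} (h0 : (p : ℝ) ≤ t) (h1 : t ≤ p + N) :
    ∃ (j : ℕ) (l : ℝ), p ≤ j ∧ j + 1 ≤ p + N ∧ 0 ≤ l ∧ l ≤ 1 ∧ t = j + l := by
  have ht : 0 ≤ t := (Nat.cast_nonneg p).trans h0
  rcases lt_or_ge ⌊t⌋₊ (p + N) with h | h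
  · exact ⟨⌊t⌋₊, t - ⌊t⌋₊, Nat.le_floor h0, h, by linarith [Nat.floor_le ht],
      by linarith [Nat.lt_floor_add_one t], by ring⟩
  · have h2 : ((p + N : ℕ) : ℝ) ≤ t := (Nat.cast_le.2 h).trans (Nat.floor_le ht)
    push_cast at h2
    refine ⟨p + N - 1, 1, by omega, by omega, zero_le_one, le_rfl, ?_⟩
    rw [Nat.cast_sub (by omega)]
    push_cast
    linarith

/-- The nodal values: the profile at the images of `N + 1` nodes on each side of the shock
position `s`. -/
noncomputable def nodalValue (T : ℝ) (N : ℕ) (s : ℝ) (k : ℕ) : ℝ :=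
  if k ≤ N then profile T (2 * π + (-π + k * (π / N)) * (1 + s / π))
  else profile T (((k : ℝ) - N - 1) * (π / N) * (1 - s / π))

theorem continuous_nodalValue {T : ℝ} (hT : π < T) (N k : ℕ) :
    Continuous fun s => nodalValue T N s k := by
  have := continuous_profile hT
  unfold nodalValue
  split_ifs <;> fun_prop

theorem abs_nodalValue_le_one (T : ℝ) (N : ℕ) (s : ℝ) (k : ℕ) : |nodalValue T N s k| ≤ 1 := by
  unfold nodalValue
  split_ifs <;> exact abs_profile_le_one _ _

theorem abs_convex_combination_le {a b l M : ℝ} (hl0 : 0 ≤ l) (hl1 : l ≤ 1) (ha : |a| ≤ M)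
    (hb : |b| ≤ M) : |(1 - l) * a + l * b| ≤ M := by
  have h1 := abs_le.1 ha
  have h2 := abs_le.1 hb
  refine abs_le.2 ⟨?_, ?_⟩ <;> nlinarith

section Reconstruction

variable {T s δ η : ℝ} {N : ℕ} {β : Fin (2 * N + 2) → ℝ}

theorem abs_reconstruction_le (hδ : 0 < δ) (hβ : ∀ k, |β k - nodalValue T N s k| ≤ η)
    {ξ : ℝ} (hξ : ξ ∈ Set.Icc (-π) π) :
    |∑ k, β k * hat (nodeCoord N δ ξ - (k : ℕ))| ≤ 1 + η := by
  obtain ⟨h0, h1⟩ := nodeCoord_mem (N := N) hδ hξ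
  obtain ⟨j, l, -, hj, hl0, hl1, ht⟩ := exists_nat_cell (p := 0) (N := 2 * N + 1)
    (t := nodeCoord N δ ξ) (by omega) (by simpa using h0) (by push_cast; linarith)
  rw [ht, sum_mul_hat (by omega) β hl0 hl1]
  have hb : ∀ k, |β k| ≤ 1 + η := fun k => by
    have h2 := abs_nodalValue_le_one T N s k
    have h3 := hβ k
    have h4 := abs_add_le (nodalValue T N s k) (β k - nodalValue T N s k)
    rw [add_sub_cancel] at h4
    linarith
  exact abs_convex_combination_le hl0 hl1 (hb _) (hb _)

theorem reconstruction_error_cell {j : ℕ} (hj : j + 1 < 2 * N + 2) (hT : π < T)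
    (hβ : ∀ k, |β k - nodalValue T N s k| ≤ η) {x₀ x₁ l : ℝ} (hl0 : 0 ≤ l) (hl1 : l ≤ 1)
    (h0 : nodalValue T N s j = profile T x₀) (h1 : nodalValue T N s (j + 1) = profile T x₁)
    (hx0 : x₀ ∈ Set.Icc 0 (2 * π)) (hx1 : x₁ ∈ Set.Icc 0 (2 * π))
    (hx : |x₁ - x₀| ≤ 2 * π / N) :
    |∑ k, β k * hat ((j + l) - (k : ℕ)) - profile T ((1 - l) * x₀ + l * x₁)| ≤
      η + (2 * π / N) ^ 2 := by
  rw [sum_mul_hat hj β hl0 hl1]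
  have e1 := profile_interpolation_error hT hx0 hx1 hl0 hl1
  have e2 := abs_convex_combination_le hl0 hl1 (hβ ⟨j, by omega⟩) (hβ ⟨j + 1, hj⟩)
  simp only [h0, h1] at e2
  have e3 : (x₁ - x₀) ^ 2 ≤ (2 * π / N) ^ 2 := by
    rw [← sq_abs]; exact pow_le_pow_left₀ (abs_nonneg _) hx 2
  have e4 := abs_le.1 e1
  have e5 := abs_le.1 e2
  refine abs_le.2 ⟨?_, ?_⟩ <;> nlinarith

theorem reconstruction_error_left (hT : π < T) (hN : 0 < N) (hδ : 0 < δ) (hs : |s| ≤ π)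
    (hβ : ∀ k, |β k - nodalValue T N s k| ≤ η) {ξ : ℝ} (hξ0 : -π ≤ ξ) (hξ : ξ ≤ -δ) :
    |∑ k, β k * hat (nodeCoord N δ ξ - (k : ℕ)) - profile T (2 * π + (shiftMap s ξ - s))| ≤
      η + (2 * π / N) ^ 2 := by
  have hπ := Real.pi_pos
  have hN' : (0 : ℝ) < N := by exact_mod_cast hN
  have hs' := abs_le.1 hs
  have hsπ : -1 ≤ s / π := by rw [le_div_iff₀ hπ]; linarith
  have hsπ' : s / π ≤ 1 := by rw [div_le_iff₀ hπ]; linarith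
  have hnode := nodeCoord_of_le (N := N) hδ hξ
  have ht0 : (0 : ℝ) ≤ N / π * ξ + N := by
    have : N / π * ξ + N = N / π * (ξ + π) := by field_simp
    rw [this]
    exact mul_nonneg (by positivity) (by linarith)
  have ht1 : N / π * ξ + N ≤ N := by
    have : N / π * ξ ≤ 0 := mul_nonpos_of_nonneg_of_nonpos (by positivity) (by linarith)
    linarith
  obtain ⟨j, l, -, hj, hl0, hl1, ht⟩ := exists_nat_cell (p := 0) hN
    (t := N / π * ξ + N) (by simpa using ht0) (by simpa using ht1)
  rw [hnode, ht]
  set node : ℕ → ℝ := fun k => 2 * π + (-π + k * (π / N)) * (1 + s / π) with hnodedef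
  have hmem : ∀ k, k ≤ N → node k ∈ Set.Icc 0 (2 * π) := by
    intro k hk
    have hk' : (k : ℝ) * (π / N) ≤ π := by
      rw [mul_div_assoc', div_le_iff₀ hN', mul_comm]
      exact mul_le_mul_of_nonneg_left (by exact_mod_cast hk) hπ.le
    have hk0 : 0 ≤ (k : ℝ) * (π / N) := by positivity
    simp only [hnodedef]
    constructor <;> nlinarith
  have key := reconstruction_error_cell (j := j) (l := l) (x₀ := node j) (x₁ := node (j + 1))
    (by omega) hT hβ hl0 hl1 (if_pos (by omega)) (if_pos (by omega)) (hmem j (by omega))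
    (hmem (j + 1) (by omega)) ?_
  · have e : (1 - l) * node j + l * node (j + 1) = 2 * π + (shiftMap s ξ - s) := by
      rw [shiftMap_of_nonpos s (by linarith : ξ ≤ 0)]
      have h3 : ξ = -π + (j + l) * (π / N) := by
        rw [← ht]; field_simp; ring
      simp only [hnodedef]
      rw [h3]
      push_cast
      ring
    rwa [e] at key
  · have e : node (j + 1) - node j = π / N * (1 + s / π) := by
      simp only [hnodedef]; push_cast; ring
    have hp : 0 < π / N := by positivity
    rw [e, abs_of_nonneg (mul_nonneg hp.le (by linarith)), show 2 * π / N = π / N * 2 by ring]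
    exact mul_le_mul_of_nonneg_left (by linarith) hp.le

theorem reconstruction_error_right (hT : π < T) (hN : 0 < N) (hδ : 0 < δ) (hs : |s| ≤ π)
    (hβ : ∀ k, |β k - nodalValue T N s k| ≤ η) {ξ : ℝ} (hξ0 : ξ ≤ π) (hξ : δ ≤ ξ) :
    |∑ k, β k * hat (nodeCoord N δ ξ - (k : ℕ)) - profile T (shiftMap s ξ - s)| ≤
      η + (2 * π / N) ^ 2 := by
  have hπ := Real.pi_pos
  have hN' : (0 : ℝ) < N := by exact_mod_cast hN
  have hs' := abs_le.1 hs
  have hsπ : -1 ≤ s / π := by rw [le_div_iff₀ hπ]; linarith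
  have hsπ' : s / π ≤ 1 := by rw [div_le_iff₀ hπ]; linarith
  have hnode := nodeCoord_of_ge (N := N) hδ hξ
  have ht0 : (0 : ℝ) ≤ N / π * ξ := mul_nonneg (by positivity) (by linarith)
  have ht1 : N / π * ξ ≤ N := by
    have : N / π * ξ ≤ N / π * π := mul_le_mul_of_nonneg_left hξ0 (by positivity)
    rwa [div_mul_cancel₀ _ hπ.ne'] at this
  obtain ⟨j, l, hj0, hj, hl0, hl1, ht⟩ := exists_nat_cell (p := N + 1) hN
    (t := N / π * ξ + N + 1) (by push_cast; linarith) (by push_cast; linarith)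
  rw [hnode, ht]
  set node : ℕ → ℝ := fun k => ((k : ℝ) - N - 1) * (π / N) * (1 - s / π) with hnodedef
  have hmem : ∀ k, N + 1 ≤ k → k ≤ 2 * N + 1 → node k ∈ Set.Icc 0 (2 * π) := by
    intro k hk hk2
    have hk1 : (0 : ℝ) ≤ (k : ℝ) - N - 1 := by
      have : ((N + 1 : ℕ) : ℝ) ≤ k := by exact_mod_cast hk
      push_cast at this; linarith
    have hk3 : (k : ℝ) - N - 1 ≤ N := by
      have : (k : ℝ) ≤ ((2 * N + 1 : ℕ) : ℝ) := by exact_mod_cast hk2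
      push_cast at this; linarith
    have hk' : ((k : ℝ) - N - 1) * (π / N) ≤ π := by
      rw [mul_div_assoc', div_le_iff₀ hN', mul_comm]
      exact mul_le_mul_of_nonneg_left hk3 hπ.le
    have hk0 : 0 ≤ ((k : ℝ) - N - 1) * (π / N) := by positivity
    simp only [hnodedef]
    constructor <;> nlinarith
  have key := reconstruction_error_cell (j := j) (l := l) (x₀ := node j) (x₁ := node (j + 1))
    (by omega) hT hβ hl0 hl1 (if_neg (by omega)) (if_neg (by omega)) (hmem j hj0 (by omega))
    (hmem (j + 1) (by omega) (by omega)) ?_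
  · have e : (1 - l) * node j + l * node (j + 1) = shiftMap s ξ - s := by
      rw [shiftMap_of_nonneg s (by linarith : 0 ≤ ξ)]
      have h3 : ξ = ((j + l) - N - 1) * (π / N) := by
        rw [← ht]; field_simp; ring
      simp only [hnodedef]
      rw [h3]
      push_cast
      ring
    rwa [e] at key
  · have e : node (j + 1) - node j = π / N * (1 - s / π) := by
      simp only [hnodedef]; push_cast; ring
    have hp : 0 < π / N := by positivity
    rw [e, abs_of_nonneg (mul_nonneg hp.le (by linarith)), show 2 * π / N = π / N * 2 by ring]
    exact mul_le_mul_of_nonneg_left (by linarith) hp.le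

end Reconstruction

/-- Hat functions in `nodeCoord` with approximate nodal values form a solution net. -/
theorem exists_deepONet_reconstruction {N : ℕ} {δ η : ℝ} (hη : 0 < η)
    {f : ℝ → Fin (2 * N + 2) → ℝ} (hf : Continuous f) (hp : Function.Periodic f (2 * π)) :
    ∃ (S : DeepONet (2 * N + 2)) (β : ℝ → Fin (2 * N + 2) → ℝ), (∀ ζ k, |β ζ k - f ζ k| ≤ η) ∧
      ∀ ζ ξ, S.eval (initialData ζ) ξ = ∑ k, β ζ k * hat (nodeCoord N δ ξ - (k : ℕ)) := by
  obtain ⟨B, hB⟩ := exists_reLUNet_approx hf hp hη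
  obtain ⟨Tr, hTr⟩ := exists_hat_trunk (2 * N + 2) (N / π) N (1 / (2 * δ)) δ
  refine ⟨⟨2, ![0, -(π / 2)], B, Tr⟩, fun ζ => B.eval ![Real.sin ζ, Real.cos ζ], hB, fun ζ ξ => ?_⟩
  simp only [DeepONet.eval, sample_initialData, hTr, nodeCoord]

/-! ### The shock position -/

/-- A continuous periodic function of the phase which agrees with the shock position in `(-π, π)`
up to `O(δ)`, except for phases near `πℤ`; the factor `1 - δ` keeps its values away from `±π`. -/
noncomputable def shockTarget (δ ζ : ℝ) : ℝ :=
  (1 - δ) * Real.arccos (Real.cos ζ) * max (-1) (min 1 (Real.sin ζ / δ))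

theorem continuous_shockTarget (δ : ℝ) : Continuous (shockTarget δ) := by
  have := Real.continuous_arccos
  unfold shockTarget
  fun_prop

theorem shockTarget_periodic (δ : ℝ) : Function.Periodic (shockTarget δ) (2 * π) := by
  intro x
  simp only [shockTarget, Real.cos_add_two_pi, Real.sin_add_two_pi]

theorem abs_shockTarget_le {δ : ℝ} (hδ1 : δ ≤ 1) (ζ : ℝ) :
    |shockTarget δ ζ| ≤ (1 - δ) * π := by
  have h1 : |max (-1) (min 1 (Real.sin ζ / δ))| ≤ 1 :=
    abs_le.2 ⟨le_max_left _ _, max_le (by norm_num) (min_le_left _ _)⟩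
  have h2 := Real.arccos_nonneg (Real.cos ζ)
  have h3 := Real.arccos_le_pi (Real.cos ζ)
  have h4 : 0 ≤ 1 - δ := by linarith
  rw [shockTarget, abs_mul, abs_of_nonneg (mul_nonneg h4 h2)]
  calc (1 - δ) * Real.arccos (Real.cos ζ) * |max (-1) (min 1 (Real.sin ζ / δ))|
      ≤ (1 - δ) * π * 1 := by gcongr
    _ = (1 - δ) * π := mul_one _

theorem exists_shock_near_shockTarget {δ ζ : ℝ} (hδ : 0 < δ) (hζ : ζ ∈ Set.Icc 0 (2 * π))
    (hgood : δ ≤ |Real.sin ζ|) :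
    ∃ s, |s| < π ∧ (s = ζ ∨ s = ζ - 2 * π) ∧ |shockTarget δ ζ - s| ≤ δ * π := by
  have hπ := Real.pi_pos
  rcases le_total ζ π with h | h
  · have hs := Real.sin_nonneg_of_nonneg_of_le_pi hζ.1 h
    rw [abs_of_nonneg hs] at hgood
    have hne : ζ ≠ π := by
      rintro rfl
      rw [Real.sin_pi] at hgood; linarith
    have hlt : ζ < π := lt_of_le_of_ne h hne
    refine ⟨ζ, by rwa [abs_of_nonneg hζ.1], Or.inl rfl, ?_⟩
    have h1 : 1 ≤ Real.sin ζ / δ := (one_le_div hδ).2 hgood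
    rw [shockTarget, Real.arccos_cos hζ.1 h, min_eq_left h1, max_eq_right (by norm_num)]
    have : (1 - δ) * ζ * 1 - ζ = -(δ * ζ) := by ring
    rw [this, abs_neg, abs_of_nonneg (mul_nonneg hδ.le hζ.1)]
    gcongr
  · have hs : Real.sin ζ ≤ 0 := by
      have := Real.sin_nonneg_of_nonneg_of_le_pi (x := 2 * π - ζ) (by linarith [hζ.2])
        (by linarith)
      rw [Real.sin_two_pi_sub] at this
      linarith
    rw [abs_of_nonpos hs] at hgood
    have hne : ζ ≠ π := by
      rintro rfl
      rw [Real.sin_pi] at hgood; linarith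
    have hlt : π < ζ := lt_of_le_of_ne h (Ne.symm hne)
    have hz : 0 ≤ 2 * π - ζ := by linarith [hζ.2]
    refine ⟨ζ - 2 * π, ?_, Or.inr rfl, ?_⟩
    · rw [abs_of_nonpos (by linarith)]; linarith
    · have h1 : Real.sin ζ / δ ≤ -1 := by rw [div_le_iff₀ hδ]; linarith
      rw [shockTarget, ← Real.cos_two_pi_sub, Real.arccos_cos hz (by linarith),
        min_eq_right (by linarith), max_eq_left h1]
      have : (1 - δ) * (2 * π - ζ) * -1 - (ζ - 2 * π) = δ * (2 * π - ζ) := by ring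
      rw [this, abs_of_nonneg (mul_nonneg hδ.le hz)]
      gcongr
      linarith

/-! ### The error estimate -/

/-- The pointwise error away from the shock. -/
theorem abs_sineSol_sub_reconstruction_le {T s s' δ η ζ : ℝ} {N : ℕ} {β : Fin (2 * N + 2) → ℝ}
    (hT : π < T) (hN : 0 < N) (hδ : 0 < δ) (hs : |s| < π) (hsζ : s = ζ ∨ s = ζ - 2 * π)
    (hs' : |s'| < π) (hss' : |s' - s| ≤ 5 * δ)
    (hβ : ∀ k, |β k - nodalValue T N s' k| ≤ η) {ξ : ℝ} (hξ : ξ ∈ Set.Icc (-π) π)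
    (hfar : 8 * δ < |shiftMap s' ξ - s|) :
    |sineSol T (shiftMap s' ξ - ζ) - ∑ k, β k * hat (nodeCoord N δ ξ - (k : ℕ))| ≤
      5 * δ + η + (2 * π / N) ^ 2 := by
  have hπ := Real.pi_pos
  have hsπ := abs_lt.1 hs
  have hsπ' := abs_lt.1 hs'
  have hss := abs_le.1 hss'
  set x := shiftMap s' ξ with hx
  have hxmem : x ∈ Set.Icc (-π) π := (bijOn_shiftMap hs').mapsTo hξ
  have hper : sineSol T (x - ζ) = sineSol T (x - s) := by
    rcases hsζ with h | h
    · rw [h]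
    · rw [h, show x - (ζ - 2 * π) = x - ζ + 2 * π by ring, sineSol_periodic T (x - ζ)]
  have hq1 : -1 ≤ s' / π := by rw [le_div_iff₀ hπ]; linarith
  have hq2 : s' / π ≤ 1 := by rw [div_le_iff₀ hπ]; linarith
  rw [hper]
  rcases lt_or_ge s x with h | h
  · -- to the right of the shock
    rw [abs_of_pos (by linarith)] at hfar
    have h0 : 0 ≤ ξ := by
      by_contra hcon
      have h1 := shiftMap_of_nonpos s' (not_le.1 hcon).le
      rw [← hx] at h1
      nlinarith [not_le.1 hcon]
    have h1 := shiftMap_of_nonneg s' h0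
    rw [← hx] at h1
    have h2 : δ ≤ ξ := by nlinarith
    have h3 := reconstruction_error_right hT hN hδ hs'.le hβ hξ.2 h2
    rw [← hx] at h3
    have h4 := sineSol_eq_profile hT (x := x - s) ⟨by linarith, by linarith [hxmem.2]⟩
    have h5 := abs_profile_sub_le hT (x - s) (x - s')
    rw [sub_sub_sub_cancel_left] at h5
    rw [h4]
    have h6 := abs_sub_le (profile T (x - s)) (profile T (x - s'))
      (∑ k, β k * hat (nodeCoord N δ ξ - (k : ℕ)))
    rw [abs_sub_comm (profile T (x - s'))] at h6
    linarith
  · -- to the left of the shock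
    rw [abs_of_nonpos (by linarith)] at hfar
    have h0 : ξ ≤ 0 := by
      by_contra hcon
      have h1 := shiftMap_of_nonneg s' (not_le.1 hcon).le
      rw [← hx] at h1
      nlinarith [not_le.1 hcon]
    have h1 := shiftMap_of_nonpos s' h0
    rw [← hx] at h1
    have h2 : ξ ≤ -δ := by nlinarith
    have h3 := reconstruction_error_left hT hN hδ hs'.le hβ hξ.1 h2
    rw [← hx] at h3
    have h4 := sineSol_eq_profile hT (x := x - s + 2 * π)
      ⟨by linarith [hxmem.1], by linarith⟩
    rw [sineSol_periodic T (x - s)] at h4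
    have h5 := abs_profile_sub_le hT (x - s + 2 * π) (2 * π + (x - s'))
    rw [show x - s + 2 * π - (2 * π + (x - s')) = s' - s by ring] at h5
    rw [h4]
    have h6 := abs_sub_le (profile T (x - s + 2 * π)) (profile T (2 * π + (x - s')))
      (∑ k, β k * hat (nodeCoord N δ ξ - (k : ℕ)))
    rw [abs_sub_comm (profile T (2 * π + (x - s')))] at h6
    linarith

open MeasureTheory in
/-- An `L²` bound for a function which is small off a short interval and bounded by `3` there. -/
theorem lintegral_sq_le_of_abs_le {D : ℝ → ℝ} {e s r : ℝ} (hr : 0 ≤ r)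
    (hbd : ∀ᵐ x ∂volume.restrict (Set.Icc (-π) π), |D x| ≤ 3)
    (hgood : ∀ᵐ x ∂volume.restrict (Set.Icc (-π) π), r < |x - s| → |D x| ≤ e) :
    ∫⁻ x in Set.Icc (-π) π, ENNReal.ofReal (D x ^ 2) ≤
      ENNReal.ofReal (2 * π * e ^ 2 + 18 * r) := by
  have hπ := Real.pi_pos
  have hle : ∀ᵐ x ∂volume.restrict (Set.Icc (-π) π), ENNReal.ofReal (D x ^ 2) ≤
      ENNReal.ofReal (e ^ 2) +
        (Set.Icc (s - r) (s + r)).indicator (fun _ => ENNReal.ofReal 9) x := by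
    filter_upwards [hbd, hgood] with x h1 h2
    by_cases hx : x ∈ Set.Icc (s - r) (s + r)
    · rw [Set.indicator_of_mem hx]
      refine le_add_of_nonneg_of_le zero_le (ENNReal.ofReal_le_ofReal ?_)
      rw [← sq_abs]
      nlinarith [abs_nonneg (D x)]
    · rw [Set.indicator_of_notMem hx, add_zero]
      refine ENNReal.ofReal_le_ofReal ?_
      rw [← sq_abs]
      refine pow_le_pow_left₀ (abs_nonneg _) (h2 ?_) 2
      by_contra hcon
      have h3 := abs_le.1 (not_lt.1 hcon)
      exact hx ⟨by linarith, by linarith⟩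
  refine (lintegral_mono_ae hle).trans ?_
  rw [lintegral_add_left measurable_const, lintegral_const, lintegral_indicator measurableSet_Icc,
    lintegral_const, Measure.restrict_apply MeasurableSet.univ, Set.univ_inter, Real.volume_Icc,
    Measure.restrict_apply MeasurableSet.univ, Set.univ_inter,
    ← ENNReal.ofReal_mul (by positivity)]
  refine (add_le_add_right (mul_le_mul_right (Measure.restrict_apply_le _ _) _) _).trans ?_
  rw [Real.volume_Icc, ← ENNReal.ofReal_mul (by norm_num),
    ← ENNReal.ofReal_add (mul_nonneg (sq_nonneg e) (by linarith))
      (mul_nonneg (by norm_num) (by linarith))]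
  exact ENNReal.ofReal_le_ofReal (by linarith)

open MeasureTheory in
/-- Phases for which the shock is close to `0` or to `±π` are rare. -/
theorem uniformShift_abs_sin_lt_le {δ : ℝ} (hδ : 0 < δ) :
    uniformShift {ζ | |Real.sin ζ| < δ} ≤ ENNReal.ofReal δ := by
  have hπ := Real.pi_pos
  have h2π : 0 < 2 * π := by linarith
  set r : ℝ := π * δ / 2 with hr
  have hr0 : 0 < r := by positivity
  -- Jordan's inequality on a quarter period
  have key : ∀ y, 0 ≤ y → y ≤ π / 2 → |Real.sin y| < δ → y < r := by
    intro y h0 h1 h2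
    have h3 := Real.mul_le_sin h0 h1
    have h4 := (le_abs_self _).trans_lt h2
    have h5 : 2 / π * y < δ := by linarith
    rw [div_mul_eq_mul_div, div_lt_iff₀ hπ] at h5
    rw [hr]; linarith
  have hsub : Set.Icc 0 (2 * π) ∩ {ζ | |Real.sin ζ| < δ} ⊆
      (Set.Icc 0 r ∪ Set.Icc (π - r) (π + r)) ∪ Set.Icc (2 * π - r) (2 * π) := by
    rintro ζ ⟨⟨h0, h1⟩, h2⟩
    have h2 : |Real.sin ζ| < δ := h2
    rcases le_total ζ (π / 2) with h3 | h3
    · exact Or.inl (Or.inl ⟨h0, (key ζ h0 h3 h2).le⟩)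
    rcases le_total ζ π with h4 | h4
    · have := key (π - ζ) (by linarith) (by linarith) (by rwa [Real.sin_pi_sub])
      exact Or.inl (Or.inr ⟨by linarith, by linarith⟩)
    rcases le_total ζ (3 * π / 2) with h5 | h5
    · have := key (ζ - π) (by linarith) (by linarith) (by rwa [Real.sin_sub_pi, abs_neg])
      exact Or.inl (Or.inr ⟨by linarith, by linarith⟩)
    · have := key (2 * π - ζ) (by linarith) (by linarith)
        (by rwa [Real.sin_two_pi_sub, abs_neg])
      exact Or.inr ⟨by linarith, by linarith⟩
  have hvol : volume (Set.Icc 0 (2 * π) ∩ {ζ | |Real.sin ζ| < δ}) ≤ ENNReal.ofReal (4 * r) := by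
    refine (measure_mono hsub).trans ((measure_union_le _ _).trans ?_)
    refine (add_le_add_left (measure_union_le _ _) _).trans ?_
    simp only [Real.volume_Icc]
    rw [← ENNReal.ofReal_add (by linarith) (by linarith),
      ← ENNReal.ofReal_add (by linarith) (by linarith)]
    exact ENNReal.ofReal_le_ofReal (by linarith)
  rw [uniformShift, ProbabilityTheory.cond_apply measurableSet_Icc, Real.volume_Icc, sub_zero,
    ← ENNReal.ofReal_inv_of_pos h2π]
  refine (mul_le_mul_right hvol _).trans ?_
  rw [← ENNReal.ofReal_mul (by positivity)]
  refine ENNReal.ofReal_le_ofReal (le_of_eq ?_)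
  rw [hr]
  field_simp
  norm_num

open MeasureTheory in
/-- The error of the system built with `N` nodes on each side of the shock and accuracy `δ`. -/
theorem exists_deepONet_pair {T : ℝ} (hT : π < T) {N : ℕ} (hN : 0 < N) {δ : ℝ} (hδ : 0 < δ)
    (hδ1 : δ ≤ 1) :
    ∃ X S : DeepONet (2 * N + 2),
      (∀ ζ, Set.BijOn (X.eval (initialData ζ)) (Set.Icc (-π) π) (Set.Icc (-π) π)) ∧
      ∀ u : ℝ → ℝ → ℝ → ℝ,
        (∀ ζ ∈ Set.Icc (0 : ℝ) (2 * π), IsBurgersEntropySolution (initialData ζ) (u ζ)) →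
        rAdaptiveError (fun ζ => u ζ T) X S ≤
          (ENNReal.ofReal (2 * π * (6 * δ + (2 * π / N) ^ 2) ^ 2 + 280 * δ)) ^ (1 / 2 : ℝ) := by
  have hπ := Real.pi_pos
  have hπ3 := Real.pi_gt_three
  have hπ4 := Real.pi_lt_four
  obtain ⟨B, hB⟩ := exists_reLUNet_approx (n := 1) (f := fun ζ _ => shockTarget δ ζ)
    (continuous_pi fun _ => continuous_shockTarget δ)
    (fun ζ => funext fun _ => shockTarget_periodic δ ζ) hδ
  set s' : ℝ → ℝ := fun ζ => B.eval ![Real.sin ζ, Real.cos ζ] 0 with hs'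
  have hs'c : Continuous s' := by
    have h1 : Continuous fun ζ : ℝ => (![Real.sin ζ, Real.cos ζ] : Fin 2 → ℝ) := by
      refine continuous_pi fun i => ?_
      fin_cases i
      · exact Real.continuous_sin
      · exact Real.continuous_cos
    exact (continuous_apply 0).comp (B.continuous_eval.comp h1)
  have hs'p : Function.Periodic s' (2 * π) := fun ζ => by
    simp only [hs', Real.sin_add_two_pi, Real.cos_add_two_pi]
  have hs'near : ∀ ζ, |s' ζ - shockTarget δ ζ| ≤ δ := fun ζ => hB ζ 0
  have hs'π : ∀ ζ, |s' ζ| < π := fun ζ => by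
    have h1 := abs_shockTarget_le hδ1 ζ
    have h2 := abs_add_le (shockTarget δ ζ) (s' ζ - shockTarget δ ζ)
    rw [add_sub_cancel] at h2
    nlinarith [hs'near ζ]
  obtain ⟨X, hX⟩ := exists_deepONet_eq_shiftMap (2 * N) B
  obtain ⟨S, β, hβ, hS⟩ := exists_deepONet_reconstruction (N := N) (δ := δ) hδ
    (f := fun ζ k => nodalValue T N (s' ζ) k)
    (continuous_pi fun k => (continuous_nodalValue hT N k).comp hs'c)
    (fun ζ => funext fun k => by simp only [hs'p ζ])
  have hbij : ∀ ζ, Set.BijOn (X.eval (initialData ζ)) (Set.Icc (-π) π) (Set.Icc (-π) π) :=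
    fun ζ => by rw [hX ζ]; exact bijOn_shiftMap (hs'π ζ)
  refine ⟨X, S, hbij, fun u hu => ?_⟩
  refine ENNReal.rpow_le_rpow ?_ (by norm_num)
  set e : ℝ := 6 * δ + (2 * π / N) ^ 2 with he
  set D : ℝ → ℝ → ℝ := fun ζ x => u ζ T x - S.eval (initialData ζ)
    (Function.invFunOn (X.eval (initialData ζ)) (Set.Icc (-π) π) x) with hD
  -- by uniqueness, the difference can be computed with the explicit solution
  have hDae : ∀ ζ ∈ Set.Icc (0 : ℝ) (2 * π), ∀ᵐ x ∂volume.restrict (Set.Icc (-π) π),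
      ∃ ξ ∈ Set.Icc (-π) π, x = shiftMap (s' ζ) ξ ∧ D ζ x = sineSol T (x - ζ) -
        ∑ k, β ζ k * hat (nodeCoord N δ ξ - (k : ℕ)) := by
    intro ζ hζ
    have h1 := (hu ζ hζ).ae_eq (isBurgersEntropySolution_sineSol ζ) (T := T) (by linarith)
    rw [restrict_Ioc_eq_restrict_Icc] at h1
    filter_upwards [h1, ae_restrict_mem measurableSet_Icc] with x hx hxm
    have h2 : x ∈ X.eval (initialData ζ) '' Set.Icc (-π) π := (hbij ζ).surjOn hxm
    refine ⟨_, Function.invFunOn_mem h2, ?_, ?_⟩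
    · have := Function.invFunOn_eq h2
      nth_rewrite 1 [hX ζ] at this
      exact this.symm
    · simp only [hD, hS, hx]
  have hbd : ∀ ζ ∈ Set.Icc (0 : ℝ) (2 * π), ∀ᵐ x ∂volume.restrict (Set.Icc (-π) π),
      |D ζ x| ≤ 3 := by
    intro ζ hζ
    filter_upwards [hDae ζ hζ] with x hx
    obtain ⟨ξ, hξ, -, hDx⟩ := hx
    rw [hDx]
    have h1 := abs_reconstruction_le (T := T) hδ (hβ ζ) hξ
    have h2 : |sineSol T (x - ζ)| ≤ 1 := by
      rw [sineSol, abs_neg]; exact Real.abs_sin_le_one _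
    exact (abs_sub _ _).trans (by linarith)
  have hinner : ∀ ζ ∈ Set.Icc (0 : ℝ) (2 * π),
      ∫⁻ x in Set.Icc (-π) π, ENNReal.ofReal (D ζ x ^ 2) ≤
        ENNReal.ofReal (2 * π * e ^ 2 + 18 * (8 * δ)) +
          {ζ | |Real.sin ζ| < δ}.indicator (fun _ => ENNReal.ofReal (18 * π)) ζ := by
    intro ζ hζ
    by_cases hg : |Real.sin ζ| < δ
    · rw [Set.indicator_of_mem (show ζ ∈ {ζ | |Real.sin ζ| < δ} from hg)]
      refine le_add_of_nonneg_of_le zero_le ?_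
      have := lintegral_sq_le_of_abs_le (D := D ζ) (e := 3) (s := 0) (r := 0) le_rfl
        (hbd ζ hζ) (by filter_upwards [hbd ζ hζ] with x hx _; exact hx)
      refine this.trans (ENNReal.ofReal_le_ofReal (by linarith))
    · rw [Set.indicator_of_notMem (show ζ ∉ {ζ | |Real.sin ζ| < δ} from hg), add_zero]
      obtain ⟨s, hs, hsζ, hst⟩ := exists_shock_near_shockTarget hδ hζ (not_lt.1 hg)
      have hss : |s' ζ - s| ≤ 5 * δ := by
        have h1 := abs_sub_le (s' ζ) (shockTarget δ ζ) s
        nlinarith [hs'near ζ]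
      refine lintegral_sq_le_of_abs_le (e := e) (s := s) (by positivity) (hbd ζ hζ) ?_
      filter_upwards [hDae ζ hζ] with x hx hfar
      obtain ⟨ξ, hξ, hxξ, hDx⟩ := hx
      rw [hDx]
      rw [hxξ] at hfar ⊢
      have := abs_sineSol_sub_reconstruction_le hT hN hδ hs hsζ (hs'π ζ) hss (hβ ζ) hξ hfar
      linarith
  have hmeas : MeasurableSet {ζ : ℝ | |Real.sin ζ| < δ} :=
    measurableSet_lt (by fun_prop) measurable_const
  have hprob : IsProbabilityMeasure uniformShift := by
    refine ProbabilityTheory.cond_isProbabilityMeasure_of_finite ?_ ?_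
    · rw [Real.volume_Icc, sub_zero]; simp [hπ]
    · rw [Real.volume_Icc]; exact ENNReal.ofReal_ne_top
  have hsupp : ∀ᵐ ζ ∂uniformShift, ζ ∈ Set.Icc 0 (2 * π) :=
    ProbabilityTheory.ae_cond_mem measurableSet_Icc
  refine (lintegral_mono_ae (hsupp.mono hinner)).trans ?_
  rw [lintegral_add_left measurable_const, lintegral_const, measure_univ, mul_one,
    lintegral_indicator hmeas, lintegral_const, Measure.restrict_apply MeasurableSet.univ,
    Set.univ_inter]
  refine (add_le_add_right (mul_le_mul_right (uniformShift_abs_sin_lt_le hδ) _) _).trans ?_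
  rw [← ENNReal.ofReal_mul (by positivity),
    ← ENNReal.ofReal_add (by positivity) (by positivity)]
  refine ENNReal.ofReal_le_ofReal ?_
  have hπ' := Real.pi_lt_d2
  nlinarith

theorem mainTheorem2 (T : ℝ) (hT : π < T) :
    (∀ ζ ∈ Set.Icc (0 : ℝ) (2 * π), ∃ u, IsBurgersEntropySolution (initialData ζ) u) ∧
    ∃ c C : ℝ, 0 < c ∧ 0 < C ∧ ∀ ε : ℝ, 0 < ε →
      ∃ (n : ℕ) (X S : DeepONet n),
        c * ε ^ (-(2 / 3) : ℝ) ≤ (n : ℝ) ∧ (n : ℝ) ≤ C * max 1 (ε ^ (-(2 / 3) : ℝ)) ∧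
        (∀ ζ ∈ Set.Icc (0 : ℝ) (2 * π),
          Set.BijOn (X.eval (initialData ζ)) (Set.Icc (-π) π) (Set.Icc (-π) π)) ∧
        ∀ u : ℝ → ℝ → ℝ → ℝ,
          (∀ ζ ∈ Set.Icc (0 : ℝ) (2 * π), IsBurgersEntropySolution (initialData ζ) (u ζ)) →
          rAdaptiveError (fun ζ => u ζ T) X S ≤ ENNReal.ofReal ε := by
  refine ⟨fun ζ _ => ⟨_, isBurgersEntropySolution_sineSol ζ⟩, 1, 40, one_pos, by norm_num,
    fun ε hε => ?_⟩
  have hπ := Real.pi_pos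
  have hπ' := Real.pi_lt_d2
  set m : ℝ := max 1 (ε ^ (-(2 / 3) : ℝ)) with hm
  have hm1 : 1 ≤ m := le_max_left _ _
  -- the interpolation error is of order `N⁻² ≤ ε`, so the rate `ε^(-2/3)` leaves room
  have hmε : 1 ≤ m ^ 2 * ε := by
    rcases le_or_gt 1 ε with h | h
    · nlinarith
    · have h1 : ε ^ (-1 : ℝ) ≤ m ^ 2 := by
        calc ε ^ (-1 : ℝ) ≤ ε ^ (-(2 / 3) * 2 : ℝ) :=
              Real.rpow_le_rpow_of_exponent_ge hε h.le (by norm_num)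
          _ = (ε ^ (-(2 / 3) : ℝ)) ^ 2 := by rw [Real.rpow_mul hε.le]; norm_num
          _ ≤ m ^ 2 := pow_le_pow_left₀ (by positivity) (le_max_right _ _) 2
      rw [Real.rpow_neg_one] at h1
      rw [inv_le_iff_one_le_mul₀ hε] at h1
      linarith
  set N : ℕ := ⌈15 * m⌉₊ with hN
  have hN1 : 15 * m ≤ N := Nat.le_ceil _
  have hN2 : (N : ℝ) < 15 * m + 1 := Nat.ceil_lt_add_one (by linarith)
  have hN0 : 0 < (N : ℝ) := by linarith
  set δ : ℝ := min 1 (min (ε / 120) (ε ^ 2 / 560)) with hδ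
  have hδ0 : 0 < δ := lt_min one_pos (lt_min (by positivity) (by positivity))
  have hδ2 : δ ≤ ε / 120 := (min_le_right _ _).trans (min_le_left _ _)
  have hδ3 : δ ≤ ε ^ 2 / 560 := (min_le_right _ _).trans (min_le_right _ _)
  obtain ⟨X, S, hX, hS⟩ := exists_deepONet_pair hT (N := N) (by exact_mod_cast hN0) hδ0
    (min_le_left _ _)
  refine ⟨2 * N + 2, X, S, ?_, ?_, fun ζ _ => hX ζ, fun u hu => (hS u hu).trans ?_⟩
  · push_cast
    have : ε ^ (-(2 / 3) : ℝ) ≤ m := le_max_right _ _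
    linarith
  · push_cast
    linarith
  · have hNε : (2 * π / N) ^ 2 ≤ ε / 5 := by
      rw [div_pow, div_le_iff₀ (by positivity)]
      have h1 : (15 * m) ^ 2 ≤ (N : ℝ) ^ 2 := pow_le_pow_left₀ (by linarith) hN1 2
      have h2 : (15 * m) ^ 2 * ε ≤ (N : ℝ) ^ 2 * ε := mul_le_mul_of_nonneg_right h1 hε.le
      nlinarith
    have he : 6 * δ + (2 * π / N) ^ 2 ≤ ε / 4 := by linarith
    have he2 : (6 * δ + (2 * π / N) ^ 2) ^ 2 ≤ (ε / 4) ^ 2 :=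
      pow_le_pow_left₀ (by positivity) he 2
    have htot : 2 * π * (6 * δ + (2 * π / N) ^ 2) ^ 2 + 280 * δ ≤ ε ^ 2 := by
      have : 2 * π * (6 * δ + (2 * π / N) ^ 2) ^ 2 ≤ 2 * π * (ε / 4) ^ 2 :=
        mul_le_mul_of_nonneg_left he2 (by linarith)
      nlinarith [sq_nonneg ε]
    calc (ENNReal.ofReal (2 * π * (6 * δ + (2 * π / N) ^ 2) ^ 2 + 280 * δ)) ^ (1 / 2 : ℝ)
        ≤ (ENNReal.ofReal (ε ^ 2)) ^ (1 / 2 : ℝ) :=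
          ENNReal.rpow_le_rpow (ENNReal.ofReal_le_ofReal htot) (by norm_num)
      _ = ENNReal.ofReal ε := by
          rw [ENNReal.ofReal_rpow_of_pos (by positivity), ← Real.sqrt_eq_rpow,
            Real.sqrt_sq hε.le]
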